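/- Let $m\ge 1$ be an integer and let $E(m)\le O(2^m,\mathbb R)$ be the extraspecial $2$-group generated by all tensor products of $m$ factors, one of which is $\sigma_1=\begin{pmatrix}0&1\\1&0\end{pmatrix}$ or $\sigma_2=\begin{pmatrix}1&0\\0&-1\end{pmatrix}$ and the others the identity matrix $I_2$. Let the real Clifford group $\mathcal C_m$ be the normalizer of $E(m)$ in $O(2^m,\mathbb R)$. A harmonic invariant of degree $d$ of $\mathcal C_m$ is a nonzero homogeneous polynomial $p$ of degree $d$ in $2^m$ variables with real coefficients such that $p(gx)=p(x)$ for all $g\in\mathcal C_m$ and $\sum_i \partial^2 p/\partial x_i^2=0$. Then the smallest positive degree of a harmonic invariant of $\mathcal C_m$ is $8$; the harmonic invariant of degree $8$ is unique up to multiplication by a nonzero scalar; and there are no harmonic invariants of degree $10$. -/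

import Mathlib

noncomputable section

namespace CliffordGroup

open Matrix

/-- The group `O(2, ℝ)`, realised by matrices with index set `Fin 2`. -/
abbrev O2 : Type := ↥(Matrix.orthogonalGroup (Fin 2) ℝ)

/-- The index set `{0, 1}^m` of the `2^m` coordinates of `⊗^m ℝ^2`. -/
abbrev Idx (m : ℕ) : Type := Fin m → Fin 2

/-- The group `O(2^m, ℝ)`, acting on `⊗^m ℝ^2 = ℝ^(2^m)`. -/
abbrev Orth (m : ℕ) : Type := ↥(Matrix.orthogonalGroup (Idx m) ℝ)

/-- The Kronecker product `A 0 ⊗ A 1 ⊗ ⋯ ⊗ A (m - 1)` of `m` matrices of size `2 × 2`. -/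
def tensor {m : ℕ} (A : Fin m → Matrix (Fin 2) (Fin 2) ℝ) : Matrix (Idx m) (Idx m) ℝ :=
  Matrix.of fun u v => ∏ i, A i (u i) (v i)

theorem tensor_mul {m : ℕ} (A B : Fin m → Matrix (Fin 2) (Fin 2) ℝ) :
    tensor A * tensor B = tensor fun i => A i * B i := by
  ext u v
  simp only [tensor, Matrix.mul_apply, Matrix.of_apply, ← Finset.prod_mul_distrib]
  exact (Fintype.prod_sum fun i k => A i (u i) k * B i k (v i)).symm

theorem tensor_one {m : ℕ} :
    tensor (fun _ : Fin m => (1 : Matrix (Fin 2) (Fin 2) ℝ)) = 1 := by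
  ext u v
  simp only [tensor, Matrix.of_apply, Matrix.one_apply, Finset.prod_ite_zero, funext_iff]
  simp

theorem transpose_tensor {m : ℕ} (A : Fin m → Matrix (Fin 2) (Fin 2) ℝ) :
    (tensor A)ᵀ = tensor fun i => (A i)ᵀ := rfl

/-- The Kronecker product of `m` orthogonal `2 × 2` matrices, as an element of `O(2^m, ℝ)`. -/
def orthTensor {m : ℕ} (A : Fin m → O2) : Orth m :=
  ⟨tensor fun i => (A i).1, by
    rw [Matrix.mem_orthogonalGroup_iff, transpose_tensor, tensor_mul, ← tensor_one]
    congr 1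
    funext i
    exact (Matrix.mem_orthogonalGroup_iff (Fin 2) ℝ).1 (A i).2⟩

/-- The matrix `σ₁ = [[0, 1], [1, 0]]`. -/
def sigma1 : O2 :=
  ⟨!![0, 1; 1, 0], by
    rw [Matrix.mem_orthogonalGroup_iff]
    ext i j
    fin_cases i <;> fin_cases j <;> simp [Matrix.mul_apply]⟩

/-- The matrix `σ₂ = [[1, 0], [0, -1]]`. -/
def sigma2 : O2 :=
  ⟨!![1, 0; 0, -1], by
    rw [Matrix.mem_orthogonalGroup_iff]
    ext i j
    fin_cases i <;> fin_cases j <;> simp [Matrix.mul_apply]⟩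

/-- `I₂ ⊗ ⋯ ⊗ I₂ ⊗ g ⊗ I₂ ⊗ ⋯ ⊗ I₂`, with `g` in position `i`. -/
def single {m : ℕ} (i : Fin m) (g : O2) : Orth m :=
  orthTensor (Function.update (fun _ => 1) i g)

/-- The extraspecial 2-group `E(m) = E(1) ⊗ ⋯ ⊗ E(1)`, generated by the tensor products of `σ₁`
and `σ₂` with `2 × 2` identity matrices. -/
def extraspecial (m : ℕ) : Subgroup (Orth m) :=
  Subgroup.closure ({g | ∃ i, g = single i sigma1} ∪ {g | ∃ i, g = single i sigma2})

/-- The real Clifford group: the normalizer of `E(m)` in `O(2^m, ℝ)`. -/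
def cliffordGroup (m : ℕ) : Subgroup (Orth m) :=
  Subgroup.normalizer (extraspecial m : Set (Orth m))

/-- Real polynomials in the `2^m` coordinates. -/
abbrev Poly (m : ℕ) : Type := MvPolynomial (Idx m) ℝ

/-- The linear substitution `p(x) ↦ p(g x)`. -/
def subst {m : ℕ} (g : Matrix (Idx m) (Idx m) ℝ) : Poly m →ₐ[ℝ] Poly m :=
  MvPolynomial.aeval fun u => ∑ v, MvPolynomial.C (g u v) * MvPolynomial.X v

/-- The Laplace operator `∑ ∂²/∂x_u²` on polynomials. -/
def laplacian (m : ℕ) : Poly m →ₗ[ℝ] Poly m :=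
  ∑ u : Idx m, (MvPolynomial.pderiv u).toLinearMap ∘ₗ (MvPolynomial.pderiv u).toLinearMap

/-- The space of polynomials invariant under the real Clifford group. -/
def invariants (m : ℕ) : Submodule ℝ (Poly m) where
  carrier := {p | ∀ g ∈ cliffordGroup m, subst g.1 p = p}
  zero_mem' := by intro g _; exact map_zero _
  add_mem' := by intro p q hp hq g hg; rw [map_add, hp g hg, hq g hg]
  smul_mem' := by intro c p hp g hg; rw [map_smul, hp g hg]

/-- The space of harmonic invariants of degree `d` of the real Clifford group: the invariant
homogeneous polynomials of degree `d` (and `0`) that are annihilated by the Laplace operator. -/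
def harmonicInvariants (m d : ℕ) : Submodule ℝ (Poly m) :=
  MvPolynomial.homogeneousSubmodule (Idx m) ℝ d ⊓ LinearMap.ker (laplacian m) ⊓ invariants m

end CliffordGroup

end

noncomputable section

open Matrix CliffordGroup

/-! ### Linear algebra preliminaries -/

/-! The upper bounds reduce to binary self-dual codes. Polarise an invariant `p` of degree `d` and
evaluate at basis vectors, indexed by `𝔽₂^m`: this gives a function `F` of `m × d` matrices over
`𝔽₂` that determines `p`. A few explicit Clifford elements constrain `F`: quadratic sign changes
force the rows to be mutually orthogonal, coordinate changes in `GL_m(𝔽₂)` and translations make `F`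
depend only on the code spanned by the rows and the all-one word, and a Hadamard matrix makes `F`
equal to its Fourier transform in one row (`cliffordForm_matrixForm`).

Let `codeSum F C` be the sum of `F` over matrices with rows in `C`. Poisson summation shows that it
vanishes on a self-orthogonal code `C ∋ 1` that is not self-dual as soon as it vanishes on all
larger self-orthogonal codes (`CliffordForm.codeSum_eq_zero_of_lt`). So for even `d` the sums over
self-dual codes determine `F` (`CliffordForm.eq_zero`). Harmonicity kills the sums over codes with a
word of weight two. Hence `p` is determined by its sums over self-dual codes of length `d` without
such words. There are none for `d = 2, 4, 6, 10`, and for `d = 8` they are all equivalent under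
permutations of coordinates, so the space has dimension at most one. Odd degrees are excluded by `-1
∈ E(m)`.

For existence, the sum of `(xᵀ n x)⁴` over `n ∈ E(m)` is invariant, and its Laplacian is a multiple
of `|x|⁶`; subtracting a multiple of `|x|⁸` makes it harmonic, and the result is nonzero at a basis
vector. -/

/-- Complements of the two kernels are both isomorphic to the common range, and the kernels have
equal dimension; the two isomorphisms are glued. This later produces the element of `GL_m(𝔽₂)`
relating two matrices with the same row space. -/
theorem LinearMap.exists_equiv_comp_eq_of_range_eq {K V W : Type*} [Field K] [AddCommGroup V]
    [Module K V] [FiniteDimensional K V] [AddCommGroup W] [Module K W] (f g : V →ₗ[K] W)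
    (h : LinearMap.range f = LinearMap.range g) : ∃ e : V ≃ₗ[K] V, ∀ x, g (e x) = f x := by
  obtain ⟨S, hS⟩ := Submodule.exists_isCompl (LinearMap.ker f)
  obtain ⟨T, hT⟩ := Submodule.exists_isCompl (LinearMap.ker g)
  let φ : S ≃ₗ[K] T := (Submodule.quotientEquivOfIsCompl _ _ hS).symm ≪≫ₗ
    f.quotKerEquivRange ≪≫ₗ LinearEquiv.ofEq _ _ h ≪≫ₗ g.quotKerEquivRange.symm ≪≫ₗ
    Submodule.quotientEquivOfIsCompl _ _ hT
  have hφ : ∀ s : S, g (φ s) = f s := by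
    intro s
    have h1 : g.quotKerEquivRange ((Submodule.quotientEquivOfIsCompl _ _ hT).symm (φ s)) =
        LinearEquiv.ofEq _ _ h (f.quotKerEquivRange
          ((Submodule.quotientEquivOfIsCompl _ _ hS).symm s)) := by
      simp [φ]
    simpa using congrArg Subtype.val h1
  have hk : Module.finrank K (LinearMap.ker f) = Module.finrank K (LinearMap.ker g) := by
    have h1 := LinearMap.finrank_range_add_finrank_ker f
    have h2 := LinearMap.finrank_range_add_finrank_ker g
    rw [h] at h1
    omega
  let ψ : LinearMap.ker f ≃ₗ[K] LinearMap.ker g := LinearEquiv.ofFinrankEq _ _ hk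
  refine ⟨(Submodule.prodEquivOfIsCompl _ _ hS).symm ≪≫ₗ LinearEquiv.prodCongr ψ φ ≪≫ₗ
    Submodule.prodEquivOfIsCompl _ _ hT, fun x => ?_⟩
  obtain ⟨⟨a, b⟩, rfl⟩ := (Submodule.prodEquivOfIsCompl _ _ hS).surjective x
  simp [hφ]

theorem exists_linearEquiv_apply_eq {K V : Type*} [Field K] [AddCommGroup V] [Module K V]
    {x y : V} (hx : x ≠ 0) (hy : y ≠ 0) : ∃ e : V ≃ₗ[K] V, e x = y := by
  obtain ⟨g, hg⟩ := Submodule.exists_linearEquiv_restrict_eq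
    ((LinearEquiv.toSpanNonzeroSingleton K V x hx).symm ≪≫ₗ
      LinearEquiv.toSpanNonzeroSingleton K V y hy)
  refine ⟨g, ?_⟩
  rw [← hg ⟨x, Submodule.mem_span_singleton_self x⟩]
  have : (LinearEquiv.toSpanNonzeroSingleton K V x hx).symm
      ⟨x, Submodule.mem_span_singleton_self x⟩ = 1 := by
    rw [LinearEquiv.symm_apply_eq]; simp
  simp [this]

/-! ### The sign character of `ZMod 2` -/

/-- The nontrivial real character of `ZMod 2`. -/
def sgn (x : ZMod 2) : ℝ := if x = 0 then 1 else -1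

theorem ZMod.two_cases (x : ZMod 2) : x = 0 ∨ x = 1 := by
  revert x; decide

@[simp] theorem sgn_zero : sgn 0 = 1 := by simp [sgn]

@[simp] theorem sgn_one : sgn 1 = -1 := by simp [sgn]

theorem sgn_add (x y : ZMod 2) : sgn (x + y) = sgn x * sgn y := by
  have h : (1 + 1 : ZMod 2) = 0 := by decide
  rcases ZMod.two_cases x with rfl | rfl <;> rcases ZMod.two_cases y with rfl | rfl <;> simp [h]

@[simp] theorem sgn_mul_self (x : ZMod 2) : sgn x * sgn x = 1 := by
  rcases ZMod.two_cases x with rfl | rfl <;> simp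

theorem sgn_sum {α : Type*} (s : Finset α) (f : α → ZMod 2) :
    sgn (∑ i ∈ s, f i) = ∏ i ∈ s, sgn (f i) := by
  classical
  induction s using Finset.induction_on with
  | empty => simp
  | insert a s ha ih => rw [Finset.sum_insert ha, Finset.prod_insert ha, sgn_add, ih]

theorem eq_zero_of_sgn_eq_one {x : ZMod 2} (h : sgn x = 1) : x = 0 := by
  rcases ZMod.two_cases x with rfl | rfl
  · rfl
  · norm_num at h

/-- Shifting the summation variable by `v` changes the sign of the sum. -/
theorem sum_sgn_mul_eq_zero {V : Type*} [AddCommGroup V] [Fintype V] (φ : V →+ ZMod 2) {v : V}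
    (hv : φ v ≠ 0) (f : V → ℝ) (hf : ∀ w, f (w + v) = f w) : ∑ w, sgn (φ w) * f w = 0 := by
  have h1 : φ v = 1 := (ZMod.two_cases _).resolve_left hv
  have h : ∑ w, sgn (φ w) * f w = ∑ w, sgn (φ (w + v)) * f (w + v) :=
    (Equiv.sum_comp (Equiv.addRight v) fun w => sgn (φ w) * f w).symm
  simp only [map_add, h1, sgn_add, hf, sgn_one, mul_neg, mul_one, neg_mul,
    Finset.sum_neg_distrib] at h
  linarith

/-! ### Binary codes and forms with the symmetries of the Clifford group -/

section Codes

variable {ι : Type*} [Fintype ι] [DecidableEq ι]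

/-- The dual of a binary code. -/
def dualCode (C : Submodule (ZMod 2) (ι → ZMod 2)) : Submodule (ZMod 2) (ι → ZMod 2) where
  carrier := {s | ∀ c ∈ C, s ⬝ᵥ c = 0}
  zero_mem' := fun c _ => by simp
  add_mem' := fun {s t} hs ht c hc => by rw [add_dotProduct, hs c hc, ht c hc, add_zero]
  smul_mem' := fun a s hs c hc => by rw [smul_dotProduct, hs c hc, smul_zero]

omit [DecidableEq ι] in
theorem mem_dualCode {C : Submodule (ZMod 2) (ι → ZMod 2)} {s : ι → ZMod 2} :
    s ∈ dualCode C ↔ ∀ c ∈ C, s ⬝ᵥ c = 0 := Iff.rfl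

omit [DecidableEq ι] in
theorem dotProduct_self_eq (s : ι → ZMod 2) : s ⬝ᵥ s = s ⬝ᵥ 1 := by
  have h : ∀ x : ZMod 2, x * x = x * 1 := by decide
  simp only [dotProduct, Pi.one_apply, h]

omit [DecidableEq ι] in
/-- Inner product with a fixed word, as an additive map. -/
def dotAddHom (s : ι → ZMod 2) : (ι → ZMod 2) →+ ZMod 2 where
  toFun c := s ⬝ᵥ c
  map_zero' := by simp
  map_add' c d := dotProduct_add s c d

omit [DecidableEq ι] in
@[simp] theorem dotAddHom_apply (s c : ι → ZMod 2) : dotAddHom s c = s ⬝ᵥ c := rfl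

open Classical in
theorem sum_sgn_dotProduct (C : Submodule (ZMod 2) (ι → ZMod 2)) (s : ι → ZMod 2) :
    ∑ c : C, sgn (s ⬝ᵥ c.1) = if s ∈ dualCode C then (Nat.card C : ℝ) else 0 := by
  split_ifs with h
  · rw [Finset.sum_congr rfl fun c _ => by rw [h c.1 c.2, sgn_zero]]
    simp
  · simp only [mem_dualCode, not_forall] at h
    obtain ⟨c, hc, hs⟩ := h
    simpa using sum_sgn_mul_eq_zero ((dotAddHom s).comp C.subtype.toAddMonoidHom)
      (v := ⟨c, hc⟩) hs (fun _ => 1) (fun _ => rfl)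

/-- Evaluate the double sum of `sgn (s ⬝ᵥ c)` over all words `s` and all `c ∈ C` in both orders. -/
theorem card_mul_card_dualCode (C : Submodule (ZMod 2) (ι → ZMod 2)) :
    Nat.card C * Nat.card (dualCode C) = 2 ^ Fintype.card ι := by
  classical
  have h : ∑ s : ι → ZMod 2, ∑ c : C, sgn (s ⬝ᵥ c.1) = Nat.card C * Nat.card (dualCode C) := by
    simp only [sum_sgn_dotProduct, ← Finset.sum_filter, Finset.sum_const, nsmul_eq_mul]
    rw [mul_comm, Nat.card_eq_fintype_card (α := dualCode C), Fintype.card_subtype]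
  have h0 : ∀ c : C, ∑ s : ι → ZMod 2, sgn (s ⬝ᵥ c.1) = if c = 0 then 2 ^ Fintype.card ι else 0 := by
    intro c
    split_ifs with hc
    · simp [hc]
    · obtain ⟨i, hi⟩ : ∃ i, c.1 i ≠ 0 := by
        by_contra! hh
        exact hc (Subtype.ext (funext hh))
      simp only [dotProduct_comm _ c.1]
      simpa using sum_sgn_mul_eq_zero (dotAddHom c.1) (v := Pi.single i 1) (by simpa using hi)
        (fun _ => 1) (fun _ => rfl)
  rw [Finset.sum_comm, Finset.sum_congr rfl fun c _ => h0 c] at h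
  simp only [Finset.sum_ite_eq', Finset.mem_univ, if_true] at h
  exact_mod_cast h.symm

/-- The symmetries of the polarisation of an invariant of the Clifford group. -/
structure CliffordForm {m : ℕ} [NeZero m] (F : Matrix (Fin m) ι (ZMod 2) → ℝ) : Prop where
  eq_zero_of_dotProduct : ∀ R i j, R i ⬝ᵥ R j ≠ 0 → F R = 0
  mul_left : ∀ (A : Matrix (Fin m) (Fin m) (ZMod 2)) (R : Matrix (Fin m) ι (ZMod 2)),
    IsUnit A → F (A * R) = F R
  translate : ∀ x R, F (R + vecMulVec x 1) = F R
  hadamard : ∀ R, F R =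
    ∑ s, (√2)⁻¹ ^ Fintype.card ι * (sgn (s ⬝ᵥ R 0) * F (R.updateRow 0 s))

open Classical in
/-- The sum of `F` over all matrices with rows in `C`. -/
def codeSum {m : ℕ} (F : Matrix (Fin m) ι (ZMod 2) → ℝ)
    (C : Submodule (ZMod 2) (ι → ZMod 2)) : ℝ :=
  ∑ c : Fin m → C, F (Matrix.of fun i => (c i).1)

/-! ### Poisson summation and induction over self-orthogonal codes -/

namespace CliffordForm

variable {m : ℕ} [NeZero m] {F : Matrix (Fin m) ι (ZMod 2) → ℝ} (hF : CliffordForm F)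
include hF


omit hF [NeZero m] in
theorem codeSum_add (C : Submodule (ZMod 2) (ι → ZMod 2)) (v : Fin m → C) :
    codeSum F C = codeSum (fun R => F (R + Matrix.of fun i => (v i).1)) C := by
  classical
  rw [codeSum, codeSum, ← Equiv.sum_comp (Equiv.addRight v)]
  rfl

/-- Poisson summation in row `0`: after the Fourier expansion, summing the character over the old
row `0` in `C` leaves only `s ∈ C^⊥`. -/
theorem codeSum_eq_sum_dualCode (C : Submodule (ZMod 2) (ι → ZMod 2)) (hC : C ≤ dualCode C) :
    codeSum F C = (√2)⁻¹ ^ Fintype.card ι *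
      ∑ s : ι → ZMod 2, open Classical in if s ∈ dualCode C then
        codeSum (fun R => F (R + vecMulVec (Pi.single 0 1) s)) C else 0 := by
  classical
  have h1 : ∀ s : ι → ZMod 2, ∑ c : Fin m → C, sgn (s ⬝ᵥ (c 0).1) *
      F ((Matrix.of fun i => (c i).1).updateRow 0 s) =
      if s ∈ dualCode C then codeSum (fun R => F (R.updateRow 0 s)) C else 0 := by
    intro s
    split_ifs with h
    · exact Finset.sum_congr rfl fun c _ => by rw [h _ (c 0).2, sgn_zero, one_mul]
    · simp only [mem_dualCode, not_forall] at h
      obtain ⟨c, hc, hs⟩ := h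
      refine sum_sgn_mul_eq_zero (((dotAddHom s).comp C.subtype.toAddMonoidHom).comp
        (Pi.evalAddMonoidHom (fun _ : Fin m => C) 0)) (v := Pi.single 0 ⟨c, hc⟩)
        (by simpa using hs) _ fun w => ?_
      congr 1
      ext i j
      by_cases hi : i = 0
      · subst hi; simp
      · simp [hi]
  -- Since `c 0 ∈ C ≤ C^⊥`, the shift `s ↦ c 0 + s` preserves `C^⊥` and turns replacement of row `0`
  -- into addition to it.
  have h2 : ∀ c : Fin m → C, ∑ s : ι → ZMod 2, (if s ∈ dualCode C then
      F ((Matrix.of fun i => (c i).1).updateRow 0 s) else 0) =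
      ∑ s : ι → ZMod 2, if s ∈ dualCode C then
        F ((Matrix.of fun i => (c i).1) + vecMulVec (Pi.single 0 1) s) else 0 := by
    intro c
    rw [← Equiv.sum_comp (Equiv.addLeft (c 0).1)]
    refine Finset.sum_congr rfl fun s _ => ?_
    rw [Equiv.coe_addLeft, (dualCode C).add_mem_iff_right (hC (c 0).2)]
    congr 2
    ext i j
    by_cases hi : i = 0
    · subst hi; simp [vecMulVec_apply]
    · simp [hi, vecMulVec_apply]
  have h3 : codeSum F C = ∑ c : Fin m → C, ∑ s, (√2)⁻¹ ^ Fintype.card ι *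
      (sgn (s ⬝ᵥ (c 0).1) * F ((Matrix.of fun i => (c i).1).updateRow 0 s)) :=
    Finset.sum_congr rfl fun c _ => hF.hadamard _
  rw [h3, Finset.sum_comm]
  simp_rw [← Finset.mul_sum, h1]
  congr 1
  have h4 : ∀ G : (ι → ZMod 2) → Matrix (Fin m) ι (ZMod 2) → ℝ,
      (∑ s, if s ∈ dualCode C then codeSum (G s) C else 0) =
      ∑ c : Fin m → C, ∑ s, if s ∈ dualCode C then G s (Matrix.of fun i => (c i).1) else 0 := by
    intro G
    rw [Finset.sum_comm]
    refine Finset.sum_congr rfl fun s _ => ?_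
    split_ifs
    · rfl
    · simp
  rw [h4 fun s R => F (R.updateRow 0 s), h4 fun s R => F (R + vecMulVec (Pi.single 0 1) s)]
  exact Finset.sum_congr rfl fun c _ => h2 c

omit hF [NeZero m] in
theorem codeSum_add_vecMulVec_of_mem (C : Submodule (ZMod 2) (ι → ZMod 2)) {s : ι → ZMod 2}
    (hs : s ∈ C) (x : Fin m → ZMod 2) :
    codeSum (fun R => F (R + vecMulVec x s)) C = codeSum F C := by
  rw [codeSum_add (F := F) C fun i => ⟨x i • s, C.smul_mem _ hs⟩]
  rfl

/-- `GL_m(𝔽₂)` is transitive on nonzero vectors, fixes `F`, and permutes the matrices with rows in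
`C`. -/
theorem codeSum_add_vecMulVec_of_ne_zero (C : Submodule (ZMod 2) (ι → ZMod 2)) (s : ι → ZMod 2)
    {x y : Fin m → ZMod 2} (hx : x ≠ 0) (hy : y ≠ 0) :
    codeSum (fun R => F (R + vecMulVec x s)) C = codeSum (fun R => F (R + vecMulVec y s)) C := by
  classical
  obtain ⟨e, he⟩ := exists_linearEquiv_apply_eq (K := ZMod 2) hx hy
  set A : Matrix (Fin m) (Fin m) (ZMod 2) := LinearMap.toMatrix' e.toLinearMap
  set B : Matrix (Fin m) (Fin m) (ZMod 2) := LinearMap.toMatrix' e.symm.toLinearMap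
  have hBA : B * A = 1 := by rw [← LinearMap.toMatrix'_comp]; simp
  have hAB : A * B = 1 := by rw [← LinearMap.toMatrix'_comp]; simp
  have hA : IsUnit A := IsUnit.of_mul_eq_one _ hAB
  have hAx : A *ᵥ x = y := by rw [LinearMap.toMatrix'_mulVec]; exact he
  let act (M : Matrix (Fin m) (Fin m) (ZMod 2)) (c : Fin m → C) : Fin m → C :=
    fun i => ∑ j, M i j • c j
  have hact : ∀ M c, (Matrix.of fun i => (act M c i).1) = M * Matrix.of fun i => (c i).1 := by
    intro M c
    ext i j
    simp [act, Matrix.mul_apply, Finset.sum_apply]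
  have hinv : ∀ M N, M * N = 1 → ∀ c, act M (act N c) = c := by
    intro M N h c
    have h2 := hact M (act N c)
    rw [hact N c, ← Matrix.mul_assoc, h, Matrix.one_mul] at h2
    funext i
    exact Subtype.ext (congrFun h2 i)
  let σ : (Fin m → C) ≃ (Fin m → C) := ⟨act A, act B, hinv B A hBA, hinv A B hAB⟩
  rw [codeSum, codeSum,
    ← Equiv.sum_comp σ fun c => F ((Matrix.of fun i => (c i).1) + vecMulVec y s)]
  refine Finset.sum_congr rfl fun c _ => ?_
  rw [← hF.mul_left A _ hA, Matrix.mul_add, mul_vecMulVec, hAx]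
  simp only [σ, Equiv.coe_fn_mk, hact]

omit hF [NeZero m] in
theorem codeSum_sup_span (C : Submodule (ZMod 2) (ι → ZMod 2)) {s : ι → ZMod 2} (hs : s ∉ C) :
    codeSum F (C ⊔ Submodule.span (ZMod 2) {s}) =
      ∑ x : Fin m → ZMod 2, codeSum (fun R => F (R + vecMulVec x s)) C := by
  classical
  simp only [codeSum]
  rw [← Fintype.sum_prod_type']
  symm
  let φ : (Fin m → ZMod 2) × (Fin m → C) → (Fin m → ↥(C ⊔ Submodule.span (ZMod 2) {s})) :=
    fun p i => ⟨(p.2 i).1 + p.1 i • s, Submodule.add_mem_sup (p.2 i).2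
      (Submodule.smul_mem _ _ (Submodule.mem_span_singleton_self s))⟩
  refine Fintype.sum_bijective φ ⟨?_, ?_⟩ _ _ fun p => rfl
  · rintro ⟨x, c⟩ ⟨y, d⟩ h
    have h1 : ∀ i, (c i).1 + x i • s = (d i).1 + y i • s := fun i =>
      congrArg Subtype.val (congrFun h i)
    have hxy : ∀ i, x i = y i := by
      intro i
      by_contra hne
      apply hs
      have h2 : (x i - y i) • s = (d i).1 - (c i).1 := by
        rw [sub_smul, sub_eq_sub_iff_add_eq_add, add_comm, h1 i]
      have h3 : (x i - y i) • s ∈ C := h2 ▸ C.sub_mem (d i).2 (c i).2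
      exact (C.smul_mem_iff (sub_ne_zero.2 hne)).1 h3
    refine Prod.ext (funext hxy) (funext fun i => Subtype.ext ?_)
    have := h1 i
    rwa [hxy i, add_left_inj] at this
  · intro r
    have h : ∀ i, ∃ (a : ZMod 2) (c : C), c.1 + a • s = (r i).1 := by
      intro i
      obtain ⟨c, hc, t, ht, hct⟩ := Submodule.mem_sup.1 (r i).2
      obtain ⟨a, rfl⟩ := Submodule.mem_span_singleton.1 ht
      exact ⟨a, ⟨c, hc⟩, hct⟩
    choose a c h using h
    exact ⟨(a, c), funext fun i => Subtype.ext (h i)⟩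

theorem codeSum_sup_span_eq (C : Submodule (ZMod 2) (ι → ZMod 2)) {s : ι → ZMod 2} (hs : s ∉ C)
    {y : Fin m → ZMod 2} (hy : y ≠ 0) :
    codeSum F (C ⊔ Submodule.span (ZMod 2) {s}) =
      codeSum F C + (2 ^ m - 1) * codeSum (fun R => F (R + vecMulVec y s)) C := by
  classical
  rw [codeSum_sup_span C hs, ← Finset.add_sum_erase _ _ (Finset.mem_univ 0)]
  congr 1
  · simp
  · rw [Finset.sum_congr rfl fun x hx =>
      hF.codeSum_add_vecMulVec_of_ne_zero C s (Finset.ne_of_mem_erase hx) hy]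
    simp [Finset.card_erase_of_mem]

/-- Let `x` be the sum over `C`. For `s ∈ C^⊥ \ C` the code `C + ⟨s⟩` is again self-orthogonal, so
its vanishing sum gives the value `-x / (2^m - 1)` to each nontrivial coset sum. Poisson summation
becomes a linear equation for `x` whose coefficient is positive. -/
theorem codeSum_eq_zero_of_lt (C : Submodule (ZMod 2) (ι → ZMod 2)) (h1 : 1 ∈ C)
    (hC : C < dualCode C) (h : ∀ D, C < D → D ≤ dualCode D → codeSum F D = 0) :
    codeSum F C = 0 := by
  classical
  have hm : 1 ≤ m := Nat.one_le_iff_ne_zero.2 (NeZero.ne m)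
  have hM : (0 : ℝ) < 2 ^ m - 1 := by
    have : (2 : ℝ) ^ 1 ≤ 2 ^ m := pow_le_pow_right₀ (by norm_num) hm
    linarith
  have hy : (Pi.single 0 1 : Fin m → ZMod 2) ≠ 0 := by simp
  set x := codeSum F C with hx
  have hin : ∀ s ∈ dualCode C, s ∉ C →
      codeSum (fun R => F (R + vecMulVec (Pi.single 0 1) s)) C = -(x / (2 ^ m - 1)) := by
    intro s hs hsC
    have hD := hF.codeSum_sup_span_eq C hsC hy
    rw [h (C ⊔ Submodule.span (ZMod 2) {s})] at hD
    · field_simp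
      linarith
    · exact lt_of_le_of_ne le_sup_left fun he =>
        hsC (he ▸ Submodule.mem_sup_right (Submodule.mem_span_singleton_self s))
    -- This is where `1 ∈ C` matters: orthogonality to `1` makes `s` orthogonal to itself.
    · have hss : s ⬝ᵥ s = 0 := by rw [dotProduct_self_eq]; exact hs 1 h1
      intro u hu v hv
      obtain ⟨c, hc, _, ht, rfl⟩ := Submodule.mem_sup.1 hu
      obtain ⟨a, rfl⟩ := Submodule.mem_span_singleton.1 ht
      obtain ⟨d, hd, _, ht, rfl⟩ := Submodule.mem_sup.1 hv
      obtain ⟨b, rfl⟩ := Submodule.mem_span_singleton.1 ht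
      simp [hC.le hc d hd, hs d hd, dotProduct_comm c s, hs c hc, hss]
  have hmain := hF.codeSum_eq_sum_dualCode C hC.le
  have hsum : ∀ s : ι → ZMod 2, (if s ∈ dualCode C then
      codeSum (fun R => F (R + vecMulVec (Pi.single 0 1) s)) C else 0) =
      (if s ∈ C then x else 0) +
        if s ∈ dualCode C ∧ s ∉ C then -(x / (2 ^ m - 1)) else 0 := by
    intro s
    by_cases hs : s ∈ C
    · simp [hs, hC.le hs, codeSum_add_vecMulVec_of_mem C hs, hx]
    · by_cases hs' : s ∈ dualCode C
      · simp [hs, hs', hin s hs' hs]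
      · simp [hs, hs']
  rw [Finset.sum_congr rfl fun s _ => hsum s, Finset.sum_add_distrib, ← Finset.sum_filter,
    ← Finset.sum_filter, Finset.sum_const, Finset.sum_const, nsmul_eq_mul, nsmul_eq_mul,
    ← Fintype.card_subtype] at hmain
  have hcard : Fintype.card {s // s ∈ C} = Nat.card C := Nat.card_eq_fintype_card.symm
  rw [hcard] at hmain
  set n : ℝ := ((Finset.univ.filter fun s => s ∈ dualCode C ∧ s ∉ C).card : ℝ) with hn
  set κ : ℝ := (√2)⁻¹ ^ Fintype.card ι with hκ
  have hκ0 : 0 < κ := by positivity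
  have hκ2 : κ ^ 2 * 2 ^ Fintype.card ι = 1 := by
    rw [hκ, ← pow_mul, mul_comm _ 2, pow_mul, inv_pow, Real.sq_sqrt (by norm_num), ← mul_pow]
    norm_num
  have hlt : (Nat.card C : ℝ) < Nat.card (dualCode C) := by
    exact_mod_cast Set.ncard_lt_ncard (SetLike.coe_ssubset_coe.2 hC) (Set.toFinite _)
  have hprod : (Nat.card C : ℝ) * Nat.card (dualCode C) = 2 ^ Fintype.card ι := by
    exact_mod_cast card_mul_card_dualCode C
  have hpos : (0 : ℝ) < Nat.card C := by exact_mod_cast Nat.card_pos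
  -- Here `κ = 2^(-d/2)` with `d` the length, and `|C|² < |C| |C^⊥| = 2^d`.
  have hκC : κ * Nat.card C < 1 := by
    by_contra! hge
    have h1 : κ ^ 2 * (Nat.card C * Nat.card C) < 1 := by
      rw [← hκ2, ← hprod]
      exact mul_lt_mul_of_pos_left (mul_lt_mul_of_pos_left hlt hpos) (pow_pos hκ0 2)
    nlinarith
  have hfac : x * (1 - κ * Nat.card C + κ * n / (2 ^ m - 1)) = 0 := by
    have : x * (1 - κ * Nat.card C + κ * n / (2 ^ m - 1)) =
      x - κ * (Nat.card C * x + n * -(x / (2 ^ m - 1))) := by ring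
    rw [this, ← hmain, sub_self]
  refine (mul_eq_zero.1 hfac).resolve_right (ne_of_gt ?_)
  have : 0 ≤ κ * n / (2 ^ m - 1) :=
    div_nonneg (mul_nonneg hκ0.le (Nat.cast_nonneg _)) hM.le
  linarith

theorem codeSum_eq_zero (h : ∀ C, dualCode C = C → codeSum F C = 0)
    (C : Submodule (ZMod 2) (ι → ZMod 2)) (h1 : 1 ∈ C) (hC : C ≤ dualCode C) :
    codeSum F C = 0 := by
  induction C using WellFoundedGT.induction with
  | ind C ih =>
    rcases hC.eq_or_lt with he | hlt
    · exact h C he.symm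
    · exact hF.codeSum_eq_zero_of_lt C h1 hlt fun D hCD hD => ih D hCD (hCD.le h1) hD

/-- The code spanned by the rows of a matrix and the all-one word. -/
def _root_.rowCode (R : Matrix (Fin m) ι (ZMod 2)) : Submodule (ZMod 2) (ι → ZMod 2) :=
  Submodule.span (ZMod 2) {1} ⊔ LinearMap.range R.vecMulLinear

/-- Modulo the all-one word the row spaces agree, so the matrices differ by an invertible left
factor and a translation, both of which fix `F`. -/
theorem eq_of_rowCode_eq {R S : Matrix (Fin m) ι (ZMod 2)} (h : rowCode R = rowCode S) :
    F R = F S := by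
  set q := (Submodule.span (ZMod 2) {(1 : ι → ZMod 2)}).mkQ with hq
  have hr : LinearMap.range (q ∘ₗ R.vecMulLinear) = LinearMap.range (q ∘ₗ S.vecMulLinear) := by
    have hmap : ∀ T : Matrix (Fin m) ι (ZMod 2), (rowCode T).map q =
        LinearMap.range (q ∘ₗ T.vecMulLinear) := by
      intro T
      rw [rowCode, Submodule.map_sup, LinearMap.range_comp, hq, Submodule.mkQ_map_self, bot_sup_eq]
    rw [← hmap, ← hmap, h]
  obtain ⟨e, he⟩ := LinearMap.exists_equiv_comp_eq_of_range_eq _ _ hr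
  have hrow : ∀ i, ∃ a : ZMod 2, a • (1 : ι → ZMod 2) = R i - e (Pi.single i 1) ᵥ* S := by
    intro i
    have h1 := he (Pi.single i 1)
    rw [LinearMap.comp_apply, LinearMap.comp_apply, eq_comm, ← sub_eq_zero, ← map_sub, hq,
      Submodule.mkQ_apply, Submodule.Quotient.mk_eq_zero, Submodule.mem_span_singleton] at h1
    simpa [Matrix.row] using h1
  choose a ha using hrow
  set A : Matrix (Fin m) (Fin m) (ZMod 2) := (LinearMap.toMatrix' e.toLinearMap)ᵀ
  have hA : IsUnit A := by
    refine IsUnit.of_mul_eq_one (LinearMap.toMatrix' e.symm.toLinearMap)ᵀ ?_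
    rw [← Matrix.transpose_mul, ← LinearMap.toMatrix'_comp]
    simp
  have hR : R = A * S + vecMulVec a 1 := by
    ext i j
    have h1 := congrFun (ha i) j
    have h2 : (A * S) i = e (Pi.single i 1) ᵥ* S := by
      ext j
      simp [A, Matrix.mul_apply, vecMul, dotProduct, LinearMap.toMatrix'_apply]
    rw [Matrix.add_apply, vecMulVec_apply, show (A * S) i j = _ from congrFun h2 j]
    simp only [Pi.smul_apply, Pi.sub_apply, smul_eq_mul] at h1
    rw [h1]; ring
  rw [hR, hF.translate, hF.mul_left A S hA]

/-- Induction on the row code. In the sum over `rowCode R`, matrices with a smaller row code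
contribute zero by induction and all others contribute `F R`, so a positive multiple of `F R`
vanishes. -/
theorem eq_zero (hd : Even (Fintype.card ι)) (h : ∀ C, dualCode C = C → codeSum F C = 0)
    (R : Matrix (Fin m) ι (ZMod 2)) : F R = 0 := by
  classical
  induction hC : rowCode R using WellFoundedLT.induction generalizing R with
  | ind C ih =>
    subst hC
    by_cases hR : ∃ i j, R i ⬝ᵥ R j ≠ 0
    · obtain ⟨i, j, hij⟩ := hR
      exact hF.eq_zero_of_dotProduct R i j hij
    push Not at hR
    have hmem : ∀ S : Matrix (Fin m) ι (ZMod 2), ∀ i, S i ∈ rowCode S := fun S i =>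
      Submodule.mem_sup_right ⟨Pi.single i 1, by simp [Matrix.row]⟩
    have hone : (1 : ι → ZMod 2) ∈ rowCode R :=
      Submodule.mem_sup_left (Submodule.mem_span_singleton_self 1)
    have hspan : ∀ D : Submodule (ZMod 2) (ι → ZMod 2), 1 ∈ D →
        ∀ S : Matrix (Fin m) ι (ZMod 2), (∀ i, S i ∈ D) → rowCode S ≤ D := by
      intro D hD S hS
      refine sup_le ((Submodule.span_singleton_le_iff_mem _ _).2 hD) ?_
      rintro _ ⟨x, rfl⟩
      rw [Matrix.vecMulLinear_apply, Matrix.vecMul_eq_sum]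
      exact D.sum_mem fun i _ => D.smul_mem _ (hS i)
    have hself : rowCode R ≤ dualCode (rowCode R) := by
      -- Even length enters only here.
      have h11 : (1 : ι → ZMod 2) ⬝ᵥ 1 = 0 := by
        simpa [dotProduct, ZMod.natCast_eq_zero_iff] using hd.two_dvd
      have hR1 : ∀ i, R i ⬝ᵥ 1 = 0 := fun i => by rw [← dotProduct_self_eq]; exact hR i i
      have hcomm : ∀ {D : Submodule (ZMod 2) (ι → ZMod 2)} {s}, s ∈ D → s ∈ dualCode (dualCode D) :=
        fun {D s} hs c hc => by rw [dotProduct_comm]; exact hc s hs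
      have ha : rowCode R ≤ dualCode (Submodule.span (ZMod 2) {1}) := by
        refine hspan _ ?_ R fun i => ?_
        all_goals
          intro c hc
          obtain ⟨a, rfl⟩ := Submodule.mem_span_singleton.1 hc
          simp [h11, hR1]
      have hb : ∀ i, rowCode R ≤ dualCode (Submodule.span (ZMod 2) {R i}) := by
        intro i
        refine hspan _ ?_ R fun j => ?_
        all_goals
          intro c hc
          obtain ⟨a, rfl⟩ := Submodule.mem_span_singleton.1 hc
          simp [dotProduct_comm 1, hR, hR1]
      refine hspan _ (fun c hc => ?_) R fun i c hc => ?_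
      · rw [dotProduct_comm]; exact ha hc _ (Submodule.mem_span_singleton_self _)
      · rw [dotProduct_comm]; exact hb i hc _ (Submodule.mem_span_singleton_self _)
    have hsum := hF.codeSum_eq_zero h _ hone hself
    have hterm : ∀ c : Fin m → rowCode R, F (Matrix.of fun i => (c i).1) =
        if rowCode (Matrix.of fun i => (c i).1) = rowCode R then F R else 0 := by
      intro c
      split_ifs with hc
      · exact hF.eq_of_rowCode_eq hc
      · exact ih _ (lt_of_le_of_ne (hspan _ hone _ fun i => (c i).2) hc) _ rfl
    rw [codeSum, Finset.sum_congr rfl fun c _ => hterm c, ← Finset.sum_filter, Finset.sum_const,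
      nsmul_eq_mul, mul_eq_zero] at hsum
    refine hsum.resolve_left ?_
    rw [← ne_eq, Nat.cast_ne_zero, ← Nat.pos_iff_ne_zero, Finset.card_pos]
    exact ⟨fun i => ⟨R i, hmem R i⟩, by simp; rfl⟩

end CliffordForm

end Codes

/-! ### Self-dual codes of small length -/

section SelfDual

variable {d : ℕ}

/-- The Hamming weight of a binary word. -/
def weight (s : Fin d → ZMod 2) : ℕ := ∑ i, (s i).val

/-- A code has no words of weight two. -/
def NoWeightTwo (C : Submodule (ZMod 2) (Fin d → ZMod 2)) : Prop :=
  ∀ i j, i ≠ j → Pi.single i 1 + Pi.single j 1 ∉ C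

theorem weight_eq_card (s : Fin d → ZMod 2) :
    weight s = (Finset.univ.filter fun i => s i = 1).card := by
  have h : ∀ x : ZMod 2, x.val = if x = 1 then 1 else 0 := by decide
  rw [weight, Finset.card_filter]
  exact Finset.sum_congr rfl fun i _ => h _

theorem weight_one_add (s : Fin d → ZMod 2) : weight (1 + s) + weight s = d := by
  have h : ∀ x : ZMod 2, (1 + x).val + x.val = 1 := by decide
  simp [weight, ← Finset.sum_add_distrib, h]

theorem weight_add (s t : Fin d → ZMod 2) :
    weight (s + t) + 2 * weight (s * t) = weight s + weight t := by
  have h : ∀ x y : ZMod 2, (x + y).val + 2 * (x * y).val = x.val + y.val := by decide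
  simp [weight, Finset.mul_sum, ← Finset.sum_add_distrib, h]

theorem two_dvd_weight_mul {s t : Fin d → ZMod 2} (h : s ⬝ᵥ t = 0) : 2 ∣ weight (s * t) := by
  rw [← ZMod.natCast_eq_zero_iff, weight]
  simpa [dotProduct] using h

theorem eq_zero_of_weight_eq_zero {s : Fin d → ZMod 2} (h : weight s = 0) : s = 0 := by
  rw [weight, Finset.sum_eq_zero_iff] at h
  funext i
  simpa using h i (Finset.mem_univ i)

theorem NoWeightTwo.weight_ne_two {C : Submodule (ZMod 2) (Fin d → ZMod 2)} (hC : NoWeightTwo C)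
    {s : Fin d → ZMod 2} (hs : s ∈ C) : weight s ≠ 2 := by
  intro h
  rw [weight_eq_card, Finset.card_eq_two] at h
  obtain ⟨i, j, hij, h⟩ := h
  refine hC i j hij ?_
  convert hs
  funext k
  have hk : s k = 1 ↔ k = i ∨ k = j := by
    simpa using Finset.ext_iff.1 h k
  rcases ZMod.two_cases (s k) with h0 | h1
  · have : ¬(k = i ∨ k = j) := by rw [← hk, h0]; decide
    push Not at this
    simp [this.1, this.2, h0]
  · rcases hk.1 h1 with rfl | rfl
    · simp [hij, h1]
    · simp [hij.symm, h1]

variable {C : Submodule (ZMod 2) (Fin d → ZMod 2)}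

theorem two_dvd_weight (hC : dualCode C = C) {s : Fin d → ZMod 2} (hs : s ∈ C) :
    2 ∣ weight s := by
  have h : s * s = s := by
    have : ∀ x : ZMod 2, x * x = x := by decide
    exact funext fun i => this _
  rw [← hC] at hs
  have := two_dvd_weight_mul (hs s (hC ▸ hs))
  rwa [h] at this

theorem one_mem_of_selfDual (hC : dualCode C = C) : 1 ∈ C := by
  rw [← hC]
  intro c hc
  rw [dotProduct_comm, ← dotProduct_self_eq]
  exact mem_dualCode.1 (hC.symm ▸ hc) c hc

theorem card_of_selfDual {k : ℕ} (hd : d = 2 * k) (hC : dualCode C = C) : Nat.card C = 2 ^ k := by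
  have h := card_mul_card_dualCode C
  rw [hC, Fintype.card_fin] at h
  exact Nat.mul_self_inj.1 (h.trans (by rw [hd, two_mul, pow_add]))

/-- In length two the all-one word itself has weight two. Otherwise a word `c ≠ 0, 1` exists, and
`c`, `1 + c` have positive even weights with sum at most six, so one weight is two. -/
theorem not_noWeightTwo_of_le_six {k : ℕ} (hd : d = 2 * k) (h0 : 0 < k) (h3 : k ≤ 3)
    (hC : dualCode C = C) : ¬NoWeightTwo C := by
  intro h2
  have h1 := one_mem_of_selfDual hC
  have hw1 : weight (1 : Fin d → ZMod 2) = d := by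
    have := weight_one_add (0 : Fin d → ZMod 2)
    simpa [weight] using this
  obtain rfl | hk : k = 1 ∨ 2 ≤ k := by omega
  · exact h2.weight_ne_two h1 (hw1.trans hd)
  have hcard := card_of_selfDual hd hC
  obtain ⟨c, hcC, hc0, hc1⟩ : ∃ c ∈ C, c ≠ 0 ∧ c ≠ 1 := by
    by_contra! hall
    have hsub : (C : Set (Fin d → ZMod 2)) ⊆ {0, 1} := fun c hc => by
      by_cases h : c = 0
      · exact Or.inl h
      · exact Or.inr (hall c hc h)
    have h4 : Nat.card C ≤ 2 := (Set.ncard_le_ncard hsub (Set.toFinite _)).trans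
      ((Set.ncard_insert_le 0 {1}).trans (by simp))
    rw [hcard] at h4
    have : 2 ^ 2 ≤ 2 ^ k := Nat.pow_le_pow_right (by norm_num) hk
    omega
  have e1 := two_dvd_weight hC hcC
  have e2 := h2.weight_ne_two hcC
  have e3 := h2.weight_ne_two (C.add_mem h1 hcC)
  have e4 := weight_one_add c
  have e5 : weight c ≠ 0 := fun h => hc0 (eq_zero_of_weight_eq_zero h)
  have e6 : weight (1 + c) ≠ 0 := fun h => hc1 (by
    have h7 := eq_zero_of_weight_eq_zero h
    funext i
    have : ∀ x : ZMod 2, 1 + x = 0 → x = 1 := by decide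
    exact this _ (congrFun h7 i))
  have e7 := two_dvd_weight hC (C.add_mem h1 hcC)
  omega

/-- The weights are `0, 4, 6, 10`. Words of weight divisible by four form a subcode `T` of order 16,
complementation exchanging `T` with the rest of `C`. Its 15 nonzero words have weight 4, for a total
of 60; but each coordinate is `1` on none or exactly 8 of the words of `T`, so the total is
divisible by 8. -/
theorem not_noWeightTwo_ten {C : Submodule (ZMod 2) (Fin 10 → ZMod 2)} (hC : dualCode C = C) :
    ¬NoWeightTwo C := by
  classical
  intro h2
  have h1 := one_mem_of_selfDual hC
  have hcard := card_of_selfDual (k := 5) rfl hC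
  have hone : ∀ s : Fin 10 → ZMod 2, 1 + (1 + s) = s := by
    have : ∀ x : ZMod 2, 1 + (1 + x) = x := by decide
    exact fun s => funext fun i => this _
  have hw : ∀ s ∈ C, weight s = 0 ∨ weight s = 4 ∨ weight s = 6 ∨ weight s = 10 := by
    intro s hs
    have e1 := two_dvd_weight hC hs
    have e2 := h2.weight_ne_two hs
    have e3 := h2.weight_ne_two (C.add_mem h1 hs)
    have e4 := weight_one_add s
    omega
  set T : Finset (Fin 10 → ZMod 2) := Finset.univ.filter fun s => s ∈ C ∧ 4 ∣ weight s with hT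
  have hmem : ∀ {s}, s ∈ T ↔ s ∈ C ∧ 4 ∣ weight s := by simp [hT]
  have hadd : ∀ s ∈ T, ∀ t ∈ T, s + t ∈ T := by
    intro s hs t ht
    rw [hmem] at *
    have h3 : 2 ∣ weight (s * t) :=
      two_dvd_weight_mul (mem_dualCode.1 (hC.symm ▸ hs.1 : s ∈ dualCode C) t ht.1)
    have h4 := weight_add s t
    exact ⟨C.add_mem hs.1 ht.1, by omega⟩
  have hTcard : T.card = 16 := by
    have h3 : (Finset.univ.filter fun s => s ∈ C ∧ ¬4 ∣ weight s).card = T.card := by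
      refine Finset.card_bij (fun s _ => 1 + s) ?_ (fun s _ t _ h => add_left_cancel h) ?_
      · intro s hs
        simp only [Finset.mem_filter, Finset.mem_univ, true_and] at hs
        have := weight_one_add s
        have := hw s hs.1
        exact hmem.2 ⟨C.add_mem h1 hs.1, by omega⟩
      · intro s hs
        rw [hmem] at hs
        refine ⟨1 + s, ?_, hone s⟩
        have := weight_one_add s
        have := hw s hs.1
        simp only [Finset.mem_filter, Finset.mem_univ, true_and]
        exact ⟨C.add_mem h1 hs.1, by omega⟩
    have h4 : (Finset.univ.filter fun s => s ∈ C).card = 32 := by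
      rw [← Fintype.card_subtype, ← Nat.card_eq_fintype_card]
      exact hcard
    have h5 := Finset.card_filter_add_card_filter_not (s := Finset.univ.filter fun s => s ∈ C)
      (fun s => 4 ∣ weight s)
    rw [Finset.filter_filter, Finset.filter_filter, h4, h3] at h5
    change T.card + T.card = 32 at h5
    omega
  have h0T : (0 : Fin 10 → ZMod 2) ∈ T := hmem.2 ⟨C.zero_mem, by simp [weight]⟩
  have hsum : ∑ s ∈ T, weight s = 60 := by
    rw [← Finset.add_sum_erase T weight h0T]
    have h3 : ∀ s ∈ T.erase 0, weight s = 4 := by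
      intro s hs
      obtain ⟨hs0, hs⟩ := Finset.mem_erase.1 hs
      rw [hmem] at hs
      have := hw s hs.1
      have : weight s ≠ 0 := fun h => hs0 (eq_zero_of_weight_eq_zero h)
      omega
    rw [Finset.sum_congr rfl h3, Finset.sum_const, Finset.card_erase_of_mem h0T, hTcard]
    simp [weight]
  have hcol : ∀ i, 8 ∣ ∑ s ∈ T, (s i).val := by
    intro i
    by_cases h : ∃ t ∈ T, t i = 1
    · obtain ⟨t, ht, hti⟩ := h
      have htt : ∀ s : Fin 10 → ZMod 2, s + t + t = s := by
        have : ∀ x y : ZMod 2, x + y + y = x := by decide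
        exact fun s => funext fun i => this _ _
      have h3 : ∑ s ∈ T, ((s + t) i).val = ∑ s ∈ T, (s i).val :=
        Finset.sum_nbij' (fun s => s + t) (fun s => s + t) (fun s hs => hadd s hs t ht)
          (fun s hs => hadd s hs t ht) (fun s _ => htt s) (fun s _ => htt s) (fun s _ => rfl)
      have h4 : ∀ s ∈ T, (s i).val + ((s + t) i).val = 1 := by
        have : ∀ x : ZMod 2, x.val + (x + 1).val = 1 := by decide
        intro s _
        rw [Pi.add_apply, hti]
        exact this _
      have h5 := Finset.sum_congr rfl h4
      rw [Finset.sum_add_distrib, h3, Finset.sum_const, hTcard, smul_eq_mul] at h5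
      omega
    · push Not at h
      rw [Finset.sum_eq_zero fun s hs => ?_]
      · exact dvd_zero 8
      · rw [(ZMod.two_cases (s i)).resolve_right (h s hs)]
        rfl
  have h8 : 8 ∣ ∑ s ∈ T, weight s := by
    simp only [weight]
    rw [Finset.sum_comm]
    exact Finset.dvd_sum fun i _ => hcol i
  rw [hsum] at h8
  omega

/-- The coordinate functionals of a code. -/
def coordFunctional (C : Submodule (ZMod 2) (Fin d → ZMod 2)) (i : Fin d) :
    Module.Dual (ZMod 2) C :=
  LinearMap.proj i ∘ₗ C.subtype

@[simp] theorem coordFunctional_apply (i : Fin d) (c : C) : coordFunctional C i c = c.1 i := rfl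

/-- If two coordinates agree on `C`, the corresponding word of weight two lies in `C^⊥ = C`. -/
theorem coordFunctional_injective (hC : dualCode C = C) (h2 : NoWeightTwo C) :
    Function.Injective (coordFunctional C) := by
  intro i j h
  by_contra hij
  apply h2 i j hij
  rw [← hC]
  intro c hc
  have h3 := LinearMap.congr_fun h ⟨c, hc⟩
  simp only [coordFunctional_apply] at h3
  have h4 : ∀ x : ZMod 2, x + x = 0 := by decide
  simp [add_dotProduct, h3, h4]

/-- The eight coordinates take the value `1` at the all-one word, and their sums with coordinate `0`
take the value `0` there. These sixteen distinct functionals exhaust the dual of the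
four-dimensional code. -/
theorem exists_coordFunctional_eq {C : Submodule (ZMod 2) (Fin 8 → ZMod 2)} (hC : dualCode C = C)
    (h2 : NoWeightTwo C) (φ : Module.Dual (ZMod 2) C)
    (hφ : φ ⟨1, one_mem_of_selfDual hC⟩ = 1) : ∃ i, coordFunctional C i = φ := by
  have h10 : (1 : ZMod 2) ≠ 0 := by decide
  let f : Fin 2 × Fin 8 → Module.Dual (ZMod 2) C := fun p =>
    if p.1 = 0 then coordFunctional C p.2 else coordFunctional C p.2 + coordFunctional C 0
  have h11 : (1 + 1 : ZMod 2) = 0 := by decide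
  have hf1 : ∀ p, f p ⟨1, one_mem_of_selfDual hC⟩ = if p.1 = 0 then 1 else 0 := by
    intro p
    simp only [f]
    split_ifs <;> simp [h11]
  have hinj : Function.Injective f := by
    rintro ⟨a, i⟩ ⟨b, j⟩ h
    have hab : (if a = 0 then 1 else 0 : ZMod 2) = if b = 0 then 1 else 0 := by
      rw [← hf1 ⟨a, i⟩, ← hf1 ⟨b, j⟩, h]
    have hab' : a = 0 ↔ b = 0 := by
      by_cases ha : a = 0 <;> by_cases hb : b = 0 <;> simp [ha, hb] at hab ⊢
    have : a = b := by omega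
    subst this
    simp only [f] at h
    split_ifs at h
    · rw [coordFunctional_injective hC h2 h]
    · rw [coordFunctional_injective hC h2 (add_right_cancel h)]
  have hfin : Finite (Module.Dual (ZMod 2) C) := Module.finite_of_finite (ZMod 2)
  have hcardD : Nat.card (Module.Dual (ZMod 2) C) = 16 := by
    have h3 := card_of_selfDual (k := 4) rfl hC
    rw [Module.natCard_eq_pow_finrank (K := ZMod 2)] at h3 ⊢
    rw [Subspace.dual_finrank_eq, h3]
    rfl
  have hbij : Function.Bijective f :=
    (Nat.bijective_iff_injective_and_card f).2 ⟨hinj, by rw [hcardD]; simp⟩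
  obtain ⟨⟨a, i⟩, hi⟩ := hbij.2 φ
  have ha : a = 0 := by
    by_contra ha
    have := hf1 ⟨a, i⟩
    rw [hi, hφ] at this
    simp [ha] at this
  exact ⟨i, by rw [← hi]; simp [f, ha]⟩

/-- The coordinates are exactly the functionals equal to `1` at the all-one word, so any linear
isomorphism preserving that word permutes them. -/
theorem exists_perm_of_selfDual_eight {C D : Submodule (ZMod 2) (Fin 8 → ZMod 2)}
    (hC : dualCode C = C) (hC2 : NoWeightTwo C) (hD : dualCode D = D) (hD2 : NoWeightTwo D) :
    ∃ (π : Equiv.Perm (Fin 8)) (θ : C ≃ₗ[ZMod 2] D), ∀ c i, (θ c).1 (π i) = c.1 i := by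
  have hrank : Module.finrank (ZMod 2) C = Module.finrank (ZMod 2) D := by
    have h3 := card_of_selfDual (k := 4) rfl hC
    have h4 := card_of_selfDual (k := 4) rfl hD
    rw [Module.natCard_eq_pow_finrank (K := ZMod 2), Nat.card_zmod] at h3 h4
    exact Nat.pow_right_injective le_rfl (h3.trans h4.symm)
  let θ₀ : C ≃ₗ[ZMod 2] D := LinearEquiv.ofFinrankEq _ _ hrank
  have hne : ∀ {E : Submodule (ZMod 2) (Fin 8 → ZMod 2)} (h : 1 ∈ E), (⟨1, h⟩ : E) ≠ 0 := by
    intro E h h0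
    have := congrFun (congrArg Subtype.val h0) 0
    simp at this
  obtain ⟨e, he⟩ := exists_linearEquiv_apply_eq (K := ZMod 2)
    (x := θ₀ ⟨1, one_mem_of_selfDual hC⟩) (y := ⟨1, one_mem_of_selfDual hD⟩)
    (by simp [hne]) (hne _)
  let θ : C ≃ₗ[ZMod 2] D := θ₀ ≪≫ₗ e
  have hθ : θ.symm ⟨1, one_mem_of_selfDual hD⟩ = ⟨1, one_mem_of_selfDual hC⟩ := by
    rw [LinearEquiv.symm_apply_eq]; exact he.symm
  have hex : ∀ i, ∃ j, coordFunctional D j = coordFunctional C i ∘ₗ θ.symm.toLinearMap := by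
    intro i
    refine exists_coordFunctional_eq hD hD2 _ ?_
    simp [hθ]
  choose π hπ using hex
  have hval : ∀ c i, (θ c).1 (π i) = c.1 i := by
    intro c i
    have := LinearMap.congr_fun (hπ i) (θ c)
    simpa using this
  have hinj : Function.Injective π := by
    intro i j hij
    refine coordFunctional_injective hC hC2 (LinearMap.ext fun c => ?_)
    rw [coordFunctional_apply, coordFunctional_apply, ← hval, ← hval, hij]
  exact ⟨Equiv.ofBijective π (Finite.injective_iff_bijective.1 hinj), θ, hval⟩

theorem codeSum_eq_of_selfDual_eight {m : ℕ} {F : Matrix (Fin m) (Fin 8) (ZMod 2) → ℝ}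
    (hF : ∀ (π : Equiv.Perm (Fin 8)) R, F (R.submatrix id π) = F R)
    {C D : Submodule (ZMod 2) (Fin 8 → ZMod 2)} (hC : dualCode C = C) (hC2 : NoWeightTwo C)
    (hD : dualCode D = D) (hD2 : NoWeightTwo D) : codeSum F C = codeSum F D := by
  classical
  obtain ⟨π, θ, h⟩ := exists_perm_of_selfDual_eight hC hC2 hD hD2
  rw [codeSum, codeSum]
  refine Fintype.sum_equiv (Equiv.piCongrRight fun _ => θ.toEquiv) _ _ fun c => ?_
  refine Eq.trans ?_ (hF π _)
  congr 1
  ext i j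
  exact (h (c i) j).symm

/-- The harmonic condition kills the code sums of codes with a word of weight two. -/
theorem codeSum_eq_zero_of_weightTwo {m : ℕ} {F : Matrix (Fin m) (Fin d) (ZMod 2) → ℝ}
    (hF : ∀ (R : Matrix (Fin m) (Fin d) (ZMod 2)) (i j : Fin d), i ≠ j →
      (∀ l, R l i = R l j) →
      ∑ x, F (R + vecMulVec x (Pi.single i 1 + Pi.single j 1)) = 0)
    (hC : dualCode C = C) (h2 : ¬NoWeightTwo C) : codeSum F C = 0 := by
  classical
  simp only [NoWeightTwo, not_forall, not_not] at h2
  obtain ⟨i, j, hij, ht⟩ := h2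
  have hcol : ∀ c ∈ C, c i = c j := by
    intro c hc
    have h := mem_dualCode.1 (hC.symm ▸ hc : c ∈ dualCode C) _ ht
    have h3 : ∀ x y : ZMod 2, x + y = 0 → x = y := by decide
    exact h3 _ _ (by simpa [dotProduct_add] using h)
  -- Adding multiples of the weight-two word to the rows only permutes the summands, so one may
  -- average over `x`; the inner sum over `x` is then zero.
  have h3 : ∑ x : Fin m → ZMod 2, codeSum F C = 0 := by
    rw [Finset.sum_congr rfl fun x _ => (CliffordForm.codeSum_add_vecMulVec_of_mem C ht x).symm]
    simp only [codeSum]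
    rw [Finset.sum_comm]
    exact Finset.sum_eq_zero fun c _ => hF _ i j hij fun l => hcol _ (c l).2
  simpa using h3

end SelfDual

/-! ### Polarisation of polynomials -/

section Polarisation

open MvPolynomial

variable {σ : Type*}

theorem pderiv_comm (u v : σ) (p : MvPolynomial σ ℝ) :
    pderiv u (pderiv v p) = pderiv v (pderiv u p) := by
  have h : ⁅pderiv (R := ℝ) u, pderiv (R := ℝ) v⁆ = 0 := by
    refine MvPolynomial.derivation_ext (R := ℝ) fun i => ?_
    classical
    simp only [Derivation.commutator_apply, pderiv_X, Pi.single_apply, Derivation.coe_zero,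
      Pi.zero_apply]
    split_ifs <;> simp
  have := DFunLike.congr_fun h p
  rwa [Derivation.commutator_apply, Derivation.coe_zero, Pi.zero_apply, sub_eq_zero] at this

instance leftCommutative_pderiv : LeftCommutative
    fun (v : σ) (L : MvPolynomial σ ℝ →ₗ[ℝ] MvPolynomial σ ℝ) => (pderiv v).toLinearMap ∘ₗ L :=
  ⟨fun u v L => LinearMap.ext fun p => pderiv_comm u v (L p)⟩

/-- The iterated partial derivative along a multiset of variables. -/
def iterPderiv (s : Multiset σ) : MvPolynomial σ ℝ →ₗ[ℝ] MvPolynomial σ ℝ :=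
  s.foldr (fun v L => (pderiv v).toLinearMap ∘ₗ L) LinearMap.id

@[simp] theorem iterPderiv_zero (p : MvPolynomial σ ℝ) : iterPderiv 0 p = p := rfl

theorem iterPderiv_cons (v : σ) (s : Multiset σ) (p : MvPolynomial σ ℝ) :
    iterPderiv (v ::ₘ s) p = pderiv v (iterPderiv s p) := by
  rw [iterPderiv, Multiset.foldr_cons]
  rfl

theorem iterPderiv_cons_eq (v : σ) (s : Multiset σ) (p : MvPolynomial σ ℝ) :
    iterPderiv (v ::ₘ s) p = iterPderiv s (pderiv v p) := by
  induction s using Multiset.induction_on with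
  | empty => rw [iterPderiv_cons]; simp
  | cons u s ih => rw [Multiset.cons_swap, iterPderiv_cons, ih, ← iterPderiv_cons]

/-- The polarisation of a form of degree `d`, evaluated at basis vectors. -/
def polar {d : ℕ} (p : MvPolynomial σ ℝ) (w : Fin d → σ) : ℝ :=
  constantCoeff (iterPderiv (Finset.univ.val.map w) p)

theorem polar_comp_perm {d : ℕ} (p : MvPolynomial σ ℝ) (w : Fin d → σ)
    (π : Equiv.Perm (Fin d)) : polar p (w ∘ π) = polar p w := by
  have h : (Finset.univ.val.map π : Multiset (Fin d)) = Finset.univ.val := by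
    exact congrArg Finset.val (Finset.map_univ_equiv π)
  rw [polar, ← Multiset.map_map, h, polar]

theorem univ_val_map_cons {d : ℕ} (v : σ) (w : Fin d → σ) :
    (Finset.univ.val.map (Fin.cons v w : Fin (d + 1) → σ)) = v ::ₘ Finset.univ.val.map w := by
  rw [Fin.univ_succ]
  simp [Function.comp_def]

theorem polar_cons {d : ℕ} (p : MvPolynomial σ ℝ) (v : σ) (w : Fin d → σ) :
    polar p (Fin.cons v w : Fin (d + 1) → σ) = polar (pderiv v p) w := by
  rw [polar, univ_val_map_cons, iterPderiv_cons_eq, polar]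

/-- Induction on the degree, recovering a form from its partial derivatives by Euler's identity. -/
theorem eq_zero_of_polar_eq_zero [Fintype σ] {d : ℕ} {p : MvPolynomial σ ℝ}
    (hp : p.IsHomogeneous d) (h : ∀ w : Fin d → σ, polar p w = 0) : p = 0 := by
  induction d generalizing p with
  | zero =>
    have h0 : p.totalDegree = 0 := (totalDegree_zero_iff_isHomogeneous _).2 hp
    rw [totalDegree_eq_zero_iff_eq_C] at h0
    have h1 : constantCoeff p = 0 := by simpa [polar] using h Fin.elim0
    rw [h0, ← constantCoeff_eq, h1, C_0]
  | succ d ih =>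
    have h1 : ∀ v, pderiv v p = 0 := fun v =>
      ih (by simpa using hp.pderiv (i := v)) fun w => by rw [← polar_cons, h]
    have h2 := hp.sum_X_mul_pderiv
    simp only [h1, mul_zero, Finset.sum_const_zero] at h2
    exact (smul_eq_zero.1 h2.symm).resolve_left d.succ_ne_zero

theorem polar_add {d : ℕ} (p q : MvPolynomial σ ℝ) (w : Fin d → σ) :
    polar (p + q) w = polar p w + polar q w := by simp [polar]

theorem polar_smul {d : ℕ} (a : ℝ) (p : MvPolynomial σ ℝ) (w : Fin d → σ) :
    polar (a • p) w = a * polar p w := by simp only [polar, map_smul, constantCoeff_smul, smul_eq_mul]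

end Polarisation

/-! ### Polarisation under linear substitutions and the Laplacian -/

section Substitution

open MvPolynomial

variable {m : ℕ}

theorem pderiv_subst (g : Matrix (Idx m) (Idx m) ℝ) (v : Idx m) (p : Poly m) :
    pderiv v (subst g p) = ∑ u, g u v • subst g (pderiv u p) := by
  induction p using MvPolynomial.induction_on with
  | C a => simp [subst]
  | add p q hp hq => simp only [map_add, hp, hq, smul_add, Finset.sum_add_distrib]
  | mul_X p u hp =>
    have h1 : pderiv v (subst g (X u)) = C (g u v) := by
      classical
      simp [subst, pderiv_X, Pi.single_apply]
    rw [map_mul, Derivation.leibniz, hp, h1]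
    classical
    simp only [Derivation.leibniz, pderiv_X, map_add, smul_add, Finset.sum_add_distrib,
      smul_eq_mul, map_mul, Finset.mul_sum, mul_smul_comm]
    congr 1
    rw [Finset.sum_eq_single u]
    · simp [smul_eq_C_mul, mul_comm]
    · intro w _ hw
      simp [hw.symm]
    · simp

theorem constantCoeff_subst (g : Matrix (Idx m) (Idx m) ℝ) (p : Poly m) :
    constantCoeff (subst g p) = constantCoeff p := by
  have h : (constantCoeff : Poly m →+* ℝ).comp (subst g : Poly m →+* Poly m) = constantCoeff := by
    refine MvPolynomial.ringHom_ext (fun r => ?_) fun i => ?_ <;> simp [subst]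
  exact RingHom.congr_fun h p

theorem polar_subst {d : ℕ} (g : Matrix (Idx m) (Idx m) ℝ) (p : Poly m) (w : Fin d → Idx m) :
    polar (subst g p) w = ∑ w' : Fin d → Idx m, (∏ l, g (w' l) (w l)) * polar p w' := by
  induction d generalizing p with
  | zero => simp [polar, constantCoeff_subst]
  | succ d ih =>
    rw [← Fin.cons_self_tail w, polar_cons, pderiv_subst, ← (Fin.consEquiv fun _ => Idx m).sum_comp,
      Fintype.sum_prod_type]
    have h1 : ∀ (f : Idx m → Poly m) (w : Fin d → Idx m),
        polar (∑ u, f u) w = ∑ u, polar (f u) w := by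
      intro f w; simp [polar]
    rw [h1]
    refine Finset.sum_congr rfl fun u _ => ?_
    rw [polar_smul, ih, Finset.mul_sum]
    refine Finset.sum_congr rfl fun w' _ => ?_
    simp [Fin.prod_univ_succ, Fin.consEquiv, polar_cons, mul_assoc, Fin.tail]

theorem polar_subst_monomial {d : ℕ} {g : Matrix (Idx m) (Idx m) ℝ} {τ : Idx m → Idx m}
    {ε : Idx m → ℝ} (hg : ∀ u v, g u v = if u = τ v then ε v else 0) (p : Poly m)
    (w : Fin d → Idx m) : polar (subst g p) w = (∏ l, ε (w l)) * polar p (τ ∘ w) := by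
  rw [polar_subst, Finset.sum_eq_single (τ ∘ w)]
  · simp [hg]
  · intro w' _ hw'
    obtain ⟨l, hl⟩ := Function.ne_iff.1 hw'
    rw [Finset.prod_eq_zero (Finset.mem_univ l), zero_mul]
    rw [hg]; exact if_neg hl
  · simp

/-- Contracting a harmonic form in two arguments gives zero. -/
theorem sum_iterPderiv_laplacian {p : Poly m} (hp : laplacian m p = 0) (s : Multiset (Idx m)) :
    ∑ v : Idx m, iterPderiv (v ::ₘ v ::ₘ s) p = 0 := by
  simp only [iterPderiv_cons_eq]
  rw [← map_sum]
  have : ∑ v : Idx m, pderiv v (pderiv v p) = laplacian m p := by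
    simp [laplacian]
  rw [this, hp, map_zero]

theorem sum_polar_eq_zero {d : ℕ} {p : Poly m} (hp : laplacian m p = 0) (w : Fin d → Idx m)
    {i j : Fin d} (hij : i ≠ j) :
    ∑ v : Idx m, polar p (fun l => if l = i ∨ l = j then v else w l) = 0 := by
  have h : ∀ v : Idx m, (Finset.univ.val.map fun l => if l = i ∨ l = j then v else w l) =
      v ::ₘ v ::ₘ ((Finset.univ.erase i).erase j).val.map w := by
    intro v
    have hj : j ∈ Finset.univ.erase i := by simp [hij.symm]
    have huniv : (Finset.univ : Finset (Fin d)).val =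
        i ::ₘ j ::ₘ ((Finset.univ.erase i).erase j).val := by
      rw [Finset.erase_val, Multiset.cons_erase hj, Finset.erase_val,
        Multiset.cons_erase (Finset.mem_univ i)]
    rw [huniv, Multiset.map_cons, Multiset.map_cons]
    simp only [true_or, or_true, if_true]
    congr 2
    refine Multiset.map_congr rfl fun l hl => ?_
    rw [Finset.mem_val, Finset.mem_erase, Finset.mem_erase] at hl
    rw [if_neg (by simp [hl.1, hl.2.1])]
  simp only [polar, h]
  rw [← map_sum, sum_iterPderiv_laplacian hp, map_zero]

end Substitution

/-! ### Elements of the Clifford group -/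

section Group

variable {m : ℕ}

/-- The index set of the coordinates as a vector space over `ZMod 2`. -/
def toVec : Idx m ≃ (Fin m → ZMod 2) := Equiv.refl _

/-- A digit as an element of `ZMod 2`. -/
def toBit : Fin 2 ≃ ZMod 2 := Equiv.refl _

@[simp] theorem toBit_zero : toBit 0 = 0 := rfl

@[simp] theorem toBit_one : toBit 1 = 1 := rfl

/-- The signed permutation matrix sending the basis vector at `v` to `(-1) ^ q v` times the one
at `f v`. -/
def signedPerm (f : (Fin m → ZMod 2) ≃ (Fin m → ZMod 2)) (q : (Fin m → ZMod 2) → ZMod 2) :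
    Orth m :=
  ⟨Matrix.of fun u v => if u = toVec.symm (f (toVec v)) then sgn (q (toVec v)) else 0, by
    rw [Matrix.mem_orthogonalGroup_iff']
    ext u v
    rw [Matrix.mul_apply, Finset.sum_eq_single (toVec.symm (f (toVec u)))]
    · by_cases h : u = v
      · subst h; simp
      · simp [h]
    · intro w _ hw
      simp [hw]
    · simp⟩

theorem signedPerm_apply (f : (Fin m → ZMod 2) ≃ (Fin m → ZMod 2))
    (q : (Fin m → ZMod 2) → ZMod 2) (u v : Idx m) : (signedPerm f q).1 u v =
      if u = toVec.symm (f (toVec v)) then sgn (q (toVec v)) else 0 := rfl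

theorem signedPerm_mul (f f' : (Fin m → ZMod 2) ≃ (Fin m → ZMod 2))
    (q q' : (Fin m → ZMod 2) → ZMod 2) :
    signedPerm f q * signedPerm f' q' = signedPerm (f'.trans f) fun v => q (f' v) + q' v := by
  apply Subtype.ext
  ext u v
  change ((signedPerm f q).1 * (signedPerm f' q').1) u v = _
  rw [Matrix.mul_apply, Finset.sum_eq_single (toVec.symm (f' (toVec v)))]
  · simp only [signedPerm_apply, if_true, Equiv.apply_symm_apply, Equiv.trans_apply, sgn_add]
    split_ifs <;> simp
  · intro w _ hw
    rw [signedPerm_apply _ _ w, if_neg hw, mul_zero]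
  · simp

theorem signedPerm_refl_zero : signedPerm (m := m) (Equiv.refl _) (fun _ => 0) = 1 := by
  apply Subtype.ext
  ext u v
  rw [signedPerm_apply]
  simp [Matrix.one_apply]

/-- The matrix `(-1) ^ c X_a Z_b`. -/
def heis (a b : Fin m → ZMod 2) (c : ZMod 2) : Orth m :=
  signedPerm (Equiv.addLeft a) fun v => b ⬝ᵥ v + c

theorem heis_mul (a b a' b' : Fin m → ZMod 2) (c c' : ZMod 2) :
    heis a b c * heis a' b' c' = heis (a + a') (b + b') (b ⬝ᵥ a' + c + c') := by
  rw [heis, heis, signedPerm_mul, heis]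
  congr 1
  · ext v : 1
    simp
  · funext v
    simp only [Equiv.coe_addLeft, dotProduct_add, add_dotProduct]
    ring

theorem heis_zero : heis (0 : Fin m → ZMod 2) 0 0 = 1 := by
  rw [← signedPerm_refl_zero, heis]
  congr 1
  · ext v : 1; simp
  · funext v; simp

theorem heis_inv (a b : Fin m → ZMod 2) (c : ZMod 2) :
    (heis a b c)⁻¹ = heis a b (b ⬝ᵥ a + c) := by
  rw [inv_eq_iff_mul_eq_one, heis_mul, ← heis_zero]
  congr 1
  · exact ZModModule.add_self a
  · exact ZModModule.add_self b
  · rw [add_assoc, add_comm c, add_assoc, ZModModule.add_self c, add_zero, ZModModule.add_self]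

theorem orth_single_apply (i : Fin m) (g : O2) (u v : Idx m) : (CliffordGroup.single i g).1 u v =
    if ∀ k, k ≠ i → u k = v k then g.1 (u i) (v i) else 0 := by
  change ∏ k, ((Function.update (fun _ => (1 : O2)) i g k).1 (u k) (v k)) = _
  rw [← Finset.mul_prod_erase _ _ (Finset.mem_univ i), Function.update_self]
  have h : ∀ k ∈ Finset.univ.erase i, (Function.update (fun _ => (1 : O2)) i g k).1 (u k) (v k) =
      if u k = v k then 1 else 0 := by
    intro k hk
    rw [Function.update_of_ne (Finset.ne_of_mem_erase hk)]
    exact Matrix.one_apply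
  rw [Finset.prod_congr rfl h, Finset.prod_ite_zero]
  simp

theorem single_sigma1 (i : Fin m) : CliffordGroup.single i sigma1 = heis (Pi.single i 1) 0 0 := by
  have h0 : ∀ x y : Fin 2, sigma1.1 x y = if toBit x = 1 + toBit y then 1 else 0 := by
    have h : (1 + 1 : ZMod 2) = 0 := by decide
    simp [Fin.forall_fin_two, sigma1, h]
  apply Subtype.ext
  ext u v
  rw [orth_single_apply, heis, signedPerm_apply, h0]
  have h1 : u = toVec.symm (Equiv.addLeft (Pi.single i 1) (toVec v)) ↔
      (∀ k, k ≠ i → u k = v k) ∧ toBit (u i) = 1 + toBit (v i) := by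
    constructor
    · rintro rfl
      refine ⟨fun k hk => ?_, ?_⟩
      · change (Pi.single i 1 : Fin m → ZMod 2) k + toVec v k = _
        simp [hk]; rfl
      · change (Pi.single i 1 : Fin m → ZMod 2) i + toVec v i = _
        simp; rfl
    · rintro ⟨h1, h2⟩
      funext k
      change _ = (Pi.single i 1 : Fin m → ZMod 2) k + toVec v k
      by_cases hk : k = i
      · subst hk; rw [Pi.single_eq_same]; exact h2
      · rw [Pi.single_eq_of_ne hk, zero_add]; exact h1 k hk
  simp only [h1, zero_dotProduct, add_zero, sgn_zero]
  split_ifs <;> tauto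

theorem single_sigma2 (i : Fin m) : CliffordGroup.single i sigma2 = heis 0 (Pi.single i 1) 0 := by
  have h0 : ∀ x y : Fin 2, sigma2.1 x y = if x = y then sgn (toBit y) else 0 := by
    simp [Fin.forall_fin_two, sigma2]
  apply Subtype.ext
  ext u v
  rw [orth_single_apply, heis, signedPerm_apply, h0]
  have h1 : u = toVec.symm (Equiv.addLeft 0 (toVec v)) ↔ (∀ k, k ≠ i → u k = v k) ∧ u i = v i := by
    simp only [Equiv.coe_addLeft, zero_add, Equiv.symm_apply_apply]
    constructor
    · rintro rfl; simp
    · rintro ⟨h1, h2⟩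
      funext k
      by_cases hk : k = i
      · subst hk; exact h2
      · exact h1 k hk
  simp only [h1, single_dotProduct, one_mul, add_zero]
  split_ifs <;> first | rfl | tauto

theorem heis_mem_extraspecial [NeZero m] (a b : Fin m → ZMod 2) (c : ZMod 2) :
    heis a b c ∈ extraspecial m := by
  have hX : ∀ i, heis (Pi.single i 1) 0 0 ∈ extraspecial m := fun i =>
    single_sigma1 i ▸ Subgroup.subset_closure (Or.inl ⟨i, rfl⟩)
  have hZ : ∀ i, heis 0 (Pi.single i 1) 0 ∈ extraspecial m := fun i =>
    single_sigma2 i ▸ Subgroup.subset_closure (Or.inr ⟨i, rfl⟩)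
  have hX' : ∀ a : Fin m → ZMod 2, heis a 0 0 ∈ extraspecial m := by
    let S : AddSubmonoid (Fin m → ZMod 2) :=
      { carrier := {a | heis a 0 0 ∈ extraspecial m}
        zero_mem' := by simp [heis_zero]
        add_mem' := fun {a b} ha hb => by
          have := (extraspecial m).mul_mem ha hb
          rw [heis_mul] at this
          simpa using this }
    intro a
    change a ∈ S
    rw [← Finset.univ_sum_single a]
    refine S.sum_mem fun i _ => ?_
    rcases ZMod.two_cases (a i) with h | h
    · rw [h, Pi.single_zero]; exact S.zero_mem
    · rw [h]; exact hX i
  have hZ' : ∀ b : Fin m → ZMod 2, heis 0 b 0 ∈ extraspecial m := by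
    let S : AddSubmonoid (Fin m → ZMod 2) :=
      { carrier := {b | heis 0 b 0 ∈ extraspecial m}
        zero_mem' := by simp [heis_zero]
        add_mem' := fun {a b} ha hb => by
          have := (extraspecial m).mul_mem ha hb
          rw [heis_mul] at this
          simpa using this }
    intro a
    change a ∈ S
    rw [← Finset.univ_sum_single a]
    refine S.sum_mem fun i _ => ?_
    rcases ZMod.two_cases (a i) with h | h
    · rw [h, Pi.single_zero]; exact S.zero_mem
    · rw [h]; exact hZ i
  -- `σ₁` and `σ₂` in the same position anticommute, so the square of their product is `-1`; this
  -- needs `m ≥ 1`.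
  have hneg : heis (0 : Fin m → ZMod 2) 0 1 ∈ extraspecial m := by
    have := mul_mem (mul_mem (hX 0) (hZ 0)) (mul_mem (hX 0) (hZ 0))
    rw [heis_mul, heis_mul] at this
    simpa [ZModModule.add_self] using this
  have hab := mul_mem (hX' a) (hZ' b)
  rw [heis_mul] at hab
  rcases ZMod.two_cases c with rfl | rfl
  · simpa using hab
  · have := mul_mem hab hneg
    rw [heis_mul] at this
    simpa using this

theorem mem_extraspecial [NeZero m] {g : Orth m} :
    g ∈ extraspecial m ↔ ∃ a b c, g = heis a b c := by
  refine ⟨fun hg => ?_, ?_⟩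
  · induction hg using Subgroup.closure_induction with
    | mem x hx =>
      rcases hx with ⟨i, rfl⟩ | ⟨i, rfl⟩
      · exact ⟨_, _, _, single_sigma1 i⟩
      · exact ⟨_, _, _, single_sigma2 i⟩
    | one => exact ⟨0, 0, 0, heis_zero.symm⟩
    | mul x y _ _ hx hy =>
      obtain ⟨a, b, c, rfl⟩ := hx
      obtain ⟨a', b', c', rfl⟩ := hy
      exact ⟨_, _, _, heis_mul ..⟩
    | inv x _ hx =>
      obtain ⟨a, b, c, rfl⟩ := hx
      exact ⟨_, _, _, heis_inv ..⟩
  · rintro ⟨a, b, c, rfl⟩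
    exact heis_mem_extraspecial a b c

theorem finite_extraspecial [NeZero m] : Finite (extraspecial m : Set (Orth m)) := by
  refine Set.Finite.subset (Set.finite_range
    fun p : (Fin m → ZMod 2) × (Fin m → ZMod 2) × ZMod 2 => heis p.1 p.2.1 p.2.2) ?_
  intro g hg
  obtain ⟨a, b, c, rfl⟩ := mem_extraspecial.1 hg
  exact ⟨(a, b, c), rfl⟩

/-- As `E(m)` is finite, an inclusion under conjugation is an equality. -/
theorem mem_cliffordGroup_of_conj [NeZero m] {g : Orth m}
    (h : ∀ n ∈ extraspecial m, g * n * g⁻¹ ∈ extraspecial m) : g ∈ cliffordGroup m :=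
  have := finite_extraspecial (m := m)
  Subgroup.mem_normalizer_fintype h

/-- The hypothesis says that conjugation takes `heis a b c` to `heis a' b' (c' + c)`. -/
theorem signedPerm_mem_cliffordGroup [NeZero m] {f : (Fin m → ZMod 2) ≃ (Fin m → ZMod 2)}
    {q : (Fin m → ZMod 2) → ZMod 2}
    (h : ∀ a b, ∃ a' b' c', (∀ v, f (a + v) = a' + f v) ∧
      ∀ v, q (a + v) + b ⬝ᵥ v = b' ⬝ᵥ f v + c' + q v) :
    signedPerm f q ∈ cliffordGroup m := by
  refine mem_cliffordGroup_of_conj fun n hn => ?_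
  obtain ⟨a, b, c, rfl⟩ := mem_extraspecial.1 hn
  obtain ⟨a', b', c', hf, hq⟩ := h a b
  have : signedPerm f q * heis a b c = heis a' b' (c' + c) * signedPerm f q := by
    rw [heis, heis, signedPerm_mul, signedPerm_mul]
    congr 1
    · ext v : 1; simp [hf]
    · funext v
      rw [Equiv.coe_addLeft, ← add_assoc, hq]
      ring
  rw [this, mul_inv_cancel_right]
  exact heis_mem_extraspecial _ _ _

theorem heis_mem_cliffordGroup [NeZero m] (a b : Fin m → ZMod 2) (c : ZMod 2) :
    heis a b c ∈ cliffordGroup m :=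
  Subgroup.le_normalizer (heis_mem_extraspecial a b c)

theorem signedPerm_quadratic_mem [NeZero m] (i j : Fin m) :
    signedPerm (Equiv.refl _) (fun v => v i * v j) ∈ cliffordGroup m := by
  refine signedPerm_mem_cliffordGroup fun a b =>
    ⟨a, b + Pi.single j (a i) + Pi.single i (a j), a i * a j, fun v => rfl, fun v => ?_⟩
  simp only [Pi.add_apply, Equiv.refl_apply, add_dotProduct, single_dotProduct]
  ring

theorem signedPerm_mulVec_mem [NeZero m] {A B : Matrix (Fin m) (Fin m) (ZMod 2)}
    (hAB : A * B = 1) (hBA : B * A = 1) :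
    signedPerm ⟨fun v => A *ᵥ v, fun v => B *ᵥ v, fun v => by simp [hBA],
      fun v => by simp [hAB]⟩ (fun _ => 0) ∈ cliffordGroup m := by
  refine signedPerm_mem_cliffordGroup fun a b =>
    ⟨A *ᵥ a, b ᵥ* B, 0, fun v => mulVec_add A a v, fun v => ?_⟩
  simp [dotProduct_mulVec, vecMul_vecMul, hBA]

/-- The orthogonal `2 × 2` Hadamard matrix. -/
def hadamardO2 : O2 :=
  ⟨(√2)⁻¹ • !![1, 1; 1, -1], by
    have h : (√2)⁻¹ * (√2)⁻¹ = (1 / 2 : ℝ) := by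
      rw [← mul_inv, Real.mul_self_sqrt (by norm_num)]; norm_num
    rw [Matrix.mem_orthogonalGroup_iff]
    ext i j
    fin_cases i <;> fin_cases j <;> simp [Matrix.mul_apply, h] <;> norm_num⟩

theorem hadamardO2_apply (x y : Fin 2) :
    hadamardO2.1 x y = (√2)⁻¹ * sgn (toBit x * toBit y) := by
  revert x y
  simp [Fin.forall_fin_two, hadamardO2]

theorem hadamardO2_mul_sigma1 : hadamardO2 * sigma1 = sigma2 * hadamardO2 := by
  apply Subtype.ext
  change hadamardO2.1 * sigma1.1 = sigma2.1 * hadamardO2.1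
  ext i j
  fin_cases i <;> fin_cases j <;> simp [Matrix.mul_apply, hadamardO2, sigma1, sigma2]

theorem hadamardO2_mul_sigma2 : hadamardO2 * sigma2 = sigma1 * hadamardO2 := by
  apply Subtype.ext
  change hadamardO2.1 * sigma2.1 = sigma1.1 * hadamardO2.1
  ext i j
  fin_cases i <;> fin_cases j <;> simp [Matrix.mul_apply, hadamardO2, sigma1, sigma2]

theorem orthTensor_mul (A B : Fin m → O2) : orthTensor A * orthTensor B = orthTensor (A * B) :=
  Subtype.ext (tensor_mul _ _)

theorem single_mul_single (i : Fin m) (g h : O2) : CliffordGroup.single i g * CliffordGroup.single i h = CliffordGroup.single i (g * h) := by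
  rw [CliffordGroup.single, CliffordGroup.single, orthTensor_mul, CliffordGroup.single]
  congr 1
  exact (Pi.mulSingle_mul (f := fun _ : Fin m => O2) i g h).symm

theorem single_comm {i j : Fin m} (hij : i ≠ j) (g h : O2) :
    CliffordGroup.single i g * CliffordGroup.single j h = CliffordGroup.single j h * CliffordGroup.single i g := by
  rw [CliffordGroup.single, CliffordGroup.single, orthTensor_mul, orthTensor_mul]
  congr 1
  exact Pi.mulSingle_commute (f := fun _ : Fin m => O2) hij g h

theorem single_hadamard_mem [NeZero m] (i : Fin m) : CliffordGroup.single i hadamardO2 ∈ cliffordGroup m := by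
  refine mem_cliffordGroup_of_conj fun n hn => ?_
  rw [extraspecial] at hn ⊢
  induction hn using Subgroup.closure_induction with
  | mem x hx =>
    rcases hx with ⟨j, rfl⟩ | ⟨j, rfl⟩
    · by_cases hij : i = j
      · subst hij
        rw [single_mul_single, hadamardO2_mul_sigma1, ← single_mul_single, mul_inv_cancel_right]
        exact Subgroup.subset_closure (Or.inr ⟨i, rfl⟩)
      · rw [single_comm hij, mul_inv_cancel_right]
        exact Subgroup.subset_closure (Or.inl ⟨j, rfl⟩)
    · by_cases hij : i = j
      · subst hij
        rw [single_mul_single, hadamardO2_mul_sigma2, ← single_mul_single, mul_inv_cancel_right]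
        exact Subgroup.subset_closure (Or.inl ⟨i, rfl⟩)
      · rw [single_comm hij, mul_inv_cancel_right]
        exact Subgroup.subset_closure (Or.inr ⟨j, rfl⟩)
  | one => simp
  | mul x y _ _ hx hy =>
    have := mul_mem hx hy
    simpa [mul_assoc] using this
  | inv x _ hx =>
    have := inv_mem hx
    simpa [mul_assoc] using this

end Group

/-! ### From invariant polynomials to forms on binary matrices -/

section Invariants

variable {m d : ℕ}

/-- The polarisation of `p` as a function of `m × d` matrices over `ZMod 2`, whose columns are
indices of coordinates. -/
def matrixForm (d : ℕ) (p : Poly m) (R : Matrix (Fin m) (Fin d) (ZMod 2)) : ℝ :=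
  polar p fun l => toVec.symm fun i => R i l

theorem matrixForm_signedPerm {p : Poly m} (hp : p ∈ invariants m)
    {f : (Fin m → ZMod 2) ≃ (Fin m → ZMod 2)} {q : (Fin m → ZMod 2) → ZMod 2}
    (h : signedPerm f q ∈ cliffordGroup m) (R : Matrix (Fin m) (Fin d) (ZMod 2)) :
    matrixForm d p R = sgn (∑ l, q fun i => R i l) *
      matrixForm d p (Matrix.of fun i l => f (fun i => R i l) i) := by
  have h1 := polar_subst_monomial (g := (signedPerm f q).1)
    (τ := fun v => toVec.symm (f (toVec v))) (ε := fun v => sgn (q (toVec v)))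
    (fun u v => signedPerm_apply f q u v) p fun l => toVec.symm fun i => R i l
  rw [hp _ h] at h1
  rw [matrixForm, h1, sgn_sum]
  simp [matrixForm, Function.comp_def]

theorem matrixForm_hadamard [NeZero m] {p : Poly m} (hp : p ∈ invariants m)
    (R : Matrix (Fin m) (Fin d) (ZMod 2)) : matrixForm d p R =
      ∑ s, (√2)⁻¹ ^ d * (sgn (s ⬝ᵥ R 0) * matrixForm d p (R.updateRow 0 s)) := by
  have h1 := polar_subst (CliffordGroup.single 0 hadamardO2).1 p fun l => toVec.symm fun i => R i l
  rw [hp _ (single_hadamard_mem 0)] at h1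
  rw [matrixForm, h1]
  symm
  refine Fintype.sum_of_injective (fun (s : Fin d → ZMod 2) l =>
    toVec.symm fun i => R.updateRow 0 s i l) ?_ _ _ ?_ ?_
  · intro s t hst
    funext l
    have := congrFun (toVec.symm.injective (congrFun hst l)) 0
    simpa using this
  -- The Hadamard matrix acts only on digit `0`, so its coefficient vanishes unless all other rows
  -- are unchanged.
  · intro w' hw'
    have : ∃ l, ¬∀ k, k ≠ 0 → w' l k = toVec.symm (fun i => R i l) k := by
      by_contra! hall
      refine hw' ⟨fun l => toVec (w' l) 0, ?_⟩
      funext l k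
      by_cases hk : k = 0
      · subst hk
        change R.updateRow 0 (fun l => toVec (w' l) 0) 0 l = _
        simp; rfl
      · rw [hall l k hk]
        change R.updateRow 0 (fun l => toVec (w' l) 0) k l = R k l
        simp [hk]
    obtain ⟨l, hl⟩ := this
    rw [Finset.prod_eq_zero (Finset.mem_univ l), zero_mul]
    rw [orth_single_apply, if_neg hl]
  · intro s
    have h2 : ∀ l, (CliffordGroup.single 0 hadamardO2).1 (toVec.symm fun i => R.updateRow 0 s i l)
        (toVec.symm fun i => R i l) = (√2)⁻¹ * sgn (s l * R 0 l) := by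
      intro l
      rw [orth_single_apply, if_pos, hadamardO2_apply]
      · congr 2
      · intro k hk
        change R.updateRow 0 s k l = R k l
        simp [hk]
    rw [Finset.prod_congr rfl fun l _ => h2 l, Finset.prod_mul_distrib, ← sgn_sum, matrixForm]
    simp [dotProduct, mul_assoc]

theorem cliffordForm_matrixForm [NeZero m] {p : Poly m} (hp : p ∈ invariants m) :
    CliffordForm (matrixForm d p) where
  eq_zero_of_dotProduct R i j h := by
    have h1 := matrixForm_signedPerm (d := d) hp (signedPerm_quadratic_mem i j) R
    have h2 : ∑ l, R i l * R j l = 1 := (ZMod.two_cases _).resolve_left h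
    rw [h2, sgn_one] at h1
    change matrixForm d p R = -1 * matrixForm d p R at h1
    linarith
  mul_left A R hA := by
    obtain ⟨u, rfl⟩ := hA
    have h1 := matrixForm_signedPerm (d := d) hp
      (signedPerm_mulVec_mem (A := u.1) (B := u.2) u.3 u.4) R
    rw [Finset.sum_const_zero, sgn_zero, one_mul] at h1
    exact h1.symm
  translate x R := by
    have h1 := matrixForm_signedPerm (d := d) hp (heis_mem_cliffordGroup x 0 0) R
    simp only [zero_dotProduct, add_zero, Finset.sum_const_zero, sgn_zero, one_mul] at h1
    rw [h1]
    congr 1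
    ext i l
    simp [add_comm]
  hadamard R := by
    simpa using matrixForm_hadamard hp R

theorem matrixForm_submatrix (p : Poly m) (π : Equiv.Perm (Fin d))
    (R : Matrix (Fin m) (Fin d) (ZMod 2)) :
    matrixForm d p (R.submatrix id π) = matrixForm d p R :=
  polar_comp_perm p (fun l => toVec.symm fun i => R i l) π

/-- As columns `i` and `j` agree, adding `x` to both runs over all equal pairs of basis vectors:
this is the contraction of two arguments. -/
theorem matrixForm_harmonic {p : Poly m} (hp : laplacian m p = 0)
    (R : Matrix (Fin m) (Fin d) (ZMod 2)) (i j : Fin d) (hij : i ≠ j) (hR : ∀ l, R l i = R l j) :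
    ∑ x, matrixForm d p (R + vecMulVec x (Pi.single i 1 + Pi.single j 1)) = 0 := by
  rw [← sum_polar_eq_zero hp (fun l => toVec.symm fun i => R i l) hij]
  refine Fintype.sum_equiv ((Equiv.addLeft fun k => R k i).trans toVec.symm) _ _ fun x => ?_
  rw [matrixForm]
  congr 1
  funext l
  rw [Equiv.trans_apply, Equiv.coe_addLeft]
  split_ifs with h
  · congr 1
    funext k
    rcases h with rfl | rfl
    · simp [vecMulVec_apply, hij]
    · simp [vecMulVec_apply, hij.symm, hR]
  · push Not at h
    congr 1
    funext k
    simp [vecMulVec_apply, h.1, h.2]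

theorem eq_zero_of_matrixForm_eq_zero {p : Poly m} (hp : p.IsHomogeneous d)
    (h : ∀ R, matrixForm d p R = 0) : p = 0 :=
  eq_zero_of_polar_eq_zero hp fun w => h (Matrix.of fun i l => toVec (w l) i)

theorem eq_zero_of_codeSum_eq_zero [NeZero m] {p : Poly m} (hd : Even d) (hp : p ∈ harmonicInvariants m d)
    (h : ∀ C, dualCode C = C → NoWeightTwo C → codeSum (matrixForm d p) C = 0) : p = 0 := by
  obtain ⟨⟨hhom, hlap⟩, hinv⟩ := hp
  refine eq_zero_of_matrixForm_eq_zero hhom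
    ((cliffordForm_matrixForm hinv).eq_zero (by simpa using hd) fun C hC => ?_)
  by_cases h2 : NoWeightTwo C
  · exact h C hC h2
  · exact codeSum_eq_zero_of_weightTwo (matrixForm_harmonic hlap) hC h2

theorem eq_zero_of_odd [NeZero m] {p : Poly m} (hd : Odd d) (hp : p ∈ harmonicInvariants m d) : p = 0 := by
  obtain ⟨⟨hhom, -⟩, hinv⟩ := hp
  refine eq_zero_of_matrixForm_eq_zero hhom fun R => ?_
  -- `heis 0 0 1` is `-1`.
  have h1 := matrixForm_signedPerm (d := d) hinv (heis_mem_cliffordGroup 0 0 1) R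
  have h2 : (d : ZMod 2) = 1 := ZMod.natCast_eq_one_iff_odd.2 hd
  simp only [zero_dotProduct, zero_add, Finset.sum_const, Finset.card_univ, Fintype.card_fin,
    nsmul_eq_mul, mul_one, h2, sgn_one, Equiv.coe_addLeft] at h1
  change _ = -1 * matrixForm d p R at h1
  linarith

theorem exists_injective_harmonicInvariants_eight [NeZero m] :
    ∃ φ : harmonicInvariants m 8 →ₗ[ℝ] ℝ, Function.Injective φ := by
  by_cases hex : ∃ D : Submodule (ZMod 2) (Fin 8 → ZMod 2), dualCode D = D ∧ NoWeightTwo D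
  · obtain ⟨D, hD, hD2⟩ := hex
    let φ : harmonicInvariants m 8 →ₗ[ℝ] ℝ :=
      { toFun := fun p => codeSum (matrixForm 8 p.1) D
        map_add' := fun p q => by
          simp [codeSum, matrixForm, polar_add, Finset.sum_add_distrib]
        map_smul' := fun a p => by
          simp [codeSum, matrixForm, polar_smul, Finset.mul_sum] }
    refine ⟨φ, ?_⟩
    rw [← LinearMap.ker_eq_bot, LinearMap.ker_eq_bot']
    intro p hp
    refine Subtype.ext (eq_zero_of_codeSum_eq_zero (by decide) p.2 fun C hC hC2 => ?_)
    rw [codeSum_eq_of_selfDual_eight (matrixForm_submatrix p.1) hC hC2 hD hD2]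
    exact hp
  -- No such code need be exhibited: if there were none, the space of harmonic invariants would be
  -- zero.
  · refine ⟨0, fun p q _ => ?_⟩
    have h0 : ∀ p : harmonicInvariants m 8, p = 0 := fun p =>
      Subtype.ext (eq_zero_of_codeSum_eq_zero (by decide) p.2 fun C hC hC2 =>
        (hex ⟨C, hC, hC2⟩).elim)
    rw [h0 p, h0 q]

end Invariants

/-! ### A harmonic invariant of degree eight -/

section DegreeEight

open MvPolynomial

variable {m : ℕ}

/-- The quadratic form of a matrix. -/
def quad (M : Matrix (Idx m) (Idx m) ℝ) : Poly m :=
  ∑ u, ∑ v, C (M u v) * (X u * X v)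

theorem quad_isHomogeneous (M : Matrix (Idx m) (Idx m) ℝ) : (quad M).IsHomogeneous 2 :=
  IsHomogeneous.sum _ _ _ fun u _ => IsHomogeneous.sum _ _ _ fun v _ => by
    simpa using (isHomogeneous_C (Idx m) (M u v)).mul
      ((isHomogeneous_X ℝ u).mul (isHomogeneous_X ℝ v))

theorem subst_quad (g M : Matrix (Idx m) (Idx m) ℝ) : subst g (quad M) = quad (gᵀ * M * g) := by
  have h1 : ∀ u, subst g (X u) = ∑ v, C (g u v) * X v := fun u => by simp [subst]
  have h2 : ∀ r, subst g (C r) = C r := fun r => by simp [subst]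
  simp only [quad, map_sum, map_mul, h1, h2, Matrix.mul_apply, Matrix.transpose_apply,
    Finset.mul_sum, Finset.sum_mul]
  have h3 : ∀ f : Idx m → Idx m → Idx m → Idx m → Poly m,
      ∑ u, ∑ v, ∑ i, ∑ j, f u v i j = ∑ i, ∑ j, ∑ v, ∑ u, f u v i j := by
    intro f
    calc _ = ∑ u, ∑ i, ∑ v, ∑ j, f u v i j :=
          Finset.sum_congr rfl fun u _ => Finset.sum_comm
      _ = ∑ i, ∑ u, ∑ v, ∑ j, f u v i j := Finset.sum_comm
      _ = ∑ i, ∑ u, ∑ j, ∑ v, f u v i j :=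
          Finset.sum_congr rfl fun i _ => Finset.sum_congr rfl fun u _ => Finset.sum_comm
      _ = ∑ i, ∑ j, ∑ u, ∑ v, f u v i j := Finset.sum_congr rfl fun i _ => Finset.sum_comm
      _ = _ := Finset.sum_congr rfl fun i _ => Finset.sum_congr rfl fun j _ => Finset.sum_comm
  rw [h3, Finset.sum_comm]
  refine Finset.sum_congr rfl fun i _ => Finset.sum_congr rfl fun j _ =>
    Finset.sum_congr rfl fun v _ => Finset.sum_congr rfl fun u _ => ?_
  ring

theorem eval_quad (M : Matrix (Idx m) (Idx m) ℝ) (u : Idx m) :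
    eval (Pi.single u 1) (quad M) = M u u := by
  simp [quad, Pi.single_apply]

/-- The coordinate function at a vector over `ZMod 2`. -/
def coord (v : Fin m → ZMod 2) : Poly m := X (toVec.symm v)

theorem quad_heis (a b : Fin m → ZMod 2) (c : ZMod 2) : quad (heis a b c).1 =
    ∑ v, C (sgn (b ⬝ᵥ v + c)) * (coord (a + v) * coord v) := by
  rw [quad, Finset.sum_comm]
  refine Fintype.sum_equiv toVec _ _ fun v => ?_
  rw [Finset.sum_eq_single (toVec.symm (a + toVec v))]
  · simp [heis, signedPerm_apply, coord]
  · intro u _ hu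
    rw [heis, signedPerm_apply, if_neg (by simpa using hu)]
    simp
  · simp

/-- The matrix is symmetric or antisymmetric according to `b ⬝ᵥ a`; in the antisymmetric case its
quadratic form is zero. -/
theorem quad_heis_self_eq (a b : Fin m → ZMod 2) (c : ZMod 2) :
    C (sgn (b ⬝ᵥ a)) * quad (heis a b c).1 = quad (heis a b c).1 := by
  have haa : ∀ v : Fin m → ZMod 2, a + (a + v) = v := fun v => by
    rw [← add_assoc, ZModModule.add_self, zero_add]
  conv_rhs => rw [quad_heis, ← Equiv.sum_comp (Equiv.addLeft a)]
  rw [quad_heis, Finset.mul_sum]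
  refine Finset.sum_congr rfl fun v _ => ?_
  rw [Equiv.coe_addLeft, haa, dotProduct_add, add_assoc, sgn_add (b ⬝ᵥ a), C_mul]
  ring

theorem pderiv_coord (u v : Fin m → ZMod 2) :
    pderiv (toVec.symm u) (coord v) = if u = v then 1 else 0 := by
  classical
  rw [coord, pderiv_X, Pi.single_apply]
  simp [eq_comm]

theorem pderiv_quad_heis (a b u : Fin m → ZMod 2) (c : ZMod 2) :
    pderiv (toVec.symm u) (quad (heis a b c).1) =
      C ((1 + sgn (b ⬝ᵥ a)) * sgn (b ⬝ᵥ u + c)) * coord (a + u) := by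
  have haa : ∀ v : Fin m → ZMod 2, a + (a + v) = v := fun v => by
    rw [← add_assoc, ZModModule.add_self, zero_add]
  have h1 : ∀ v, u = a + v ↔ a + u = v := fun v =>
    ⟨fun h => by rw [h, haa], fun h => by rw [← h, haa]⟩
  have h2 : sgn (b ⬝ᵥ (a + u) + c) = sgn (b ⬝ᵥ a) * sgn (b ⬝ᵥ u + c) := by
    rw [dotProduct_add, add_assoc, sgn_add]
  rw [quad_heis, map_sum]
  simp only [pderiv_C_mul]
  simp only [Derivation.leibniz, pderiv_coord, smul_eq_mul, mul_ite, mul_one,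
    mul_zero, mul_add, Finset.sum_add_distrib, h1, Finset.sum_ite_eq, Finset.mem_univ, if_true]
  rw [h2, add_mul, C_add, one_mul]
  ring

theorem laplacian_apply (p : Poly m) : laplacian m p =
    ∑ u : Fin m → ZMod 2, pderiv (toVec.symm u) (pderiv (toVec.symm u) p) := by
  rw [laplacian, LinearMap.sum_apply]
  exact Fintype.sum_equiv toVec _ _ fun u => rfl

theorem laplacian_pow_four (q : Poly m) : laplacian m (q ^ 4) =
    12 * q ^ 2 * (∑ u, pderiv (toVec.symm u) q ^ 2) + 4 * q ^ 3 * laplacian m q := by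
  rw [laplacian_apply, laplacian_apply, Finset.mul_sum, Finset.mul_sum, ← Finset.sum_add_distrib]
  refine Finset.sum_congr rfl fun u _ => ?_
  have h4 : pderiv (toVec.symm u) (q ^ 4) = 4 * (q ^ 3 * pderiv (toVec.symm u) q) := by
    simp [Derivation.leibniz_pow]
  have h3 : pderiv (toVec.symm u) (q ^ 3) = 3 * (q ^ 2 * pderiv (toVec.symm u) q) := by
    simp [Derivation.leibniz_pow]
  have hc : (4 : Poly m) = C 4 := (map_ofNat C 4).symm
  rw [h4, hc, pderiv_C_mul, ← hc, Derivation.leibniz, h3]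
  simp only [smul_eq_mul]
  ring

/-- The quadratic form `∑ x_u ^ 2`. -/
def normForm (m : ℕ) : Poly m := quad 1

theorem normForm_eq : normForm m = ∑ v, coord v ^ 2 := by
  change quad (1 : Orth m).1 = _
  rw [← heis_zero, quad_heis]
  simp [sq]

theorem sum_sgn_dotProduct_univ (b : Fin m → ZMod 2) (c : ZMod 2) :
    ∑ u, sgn (b ⬝ᵥ u + c) = if b = 0 then 2 ^ m * sgn c else 0 := by
  split_ifs with h
  · simp [h]
  · obtain ⟨i, hi⟩ := Function.ne_iff.1 h
    simp only [sgn_add]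
    exact sum_sgn_mul_eq_zero (dotAddHom b) (v := Pi.single i 1) (by simpa using hi)
      (fun _ => sgn c) fun _ => rfl

theorem laplacian_quad_heis (a b : Fin m → ZMod 2) (c : ZMod 2) :
    laplacian m (quad (heis a b c).1) =
      if a = 0 ∧ b = 0 then C (2 * 2 ^ m * sgn c) else 0 := by
  have h1 : ∀ u, u = a + u ↔ a = 0 := fun u => by simp
  rw [laplacian_apply]
  simp only [pderiv_quad_heis, pderiv_C_mul, pderiv_coord, h1]
  by_cases ha : a = 0
  · simp only [ha, if_true, mul_one, dotProduct_zero, sgn_zero, true_and]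
    rw [← map_sum, ← Finset.mul_sum, sum_sgn_dotProduct_univ]
    split_ifs
    · congr 1; ring
    · simp
  · simp [ha]

/-- For a nonzero form `q` the matrix is symmetric and orthogonal, so `|∇q|² = 4|x|²`, while `Δq` is
twice the trace and vanishes except for `±1`. -/
theorem laplacian_quad_heis_pow_four (a b : Fin m → ZMod 2) (c : ZMod 2) :
    laplacian m (quad (heis a b c).1 ^ 4) = 48 * quad (heis a b c).1 ^ 2 * normForm m +
      if a = 0 ∧ b = 0 then C (8 * 2 ^ m) * normForm m ^ 3 else 0 := by
  have hs : ∀ x : ZMod 2, (sgn x) ^ 2 = 1 := fun x => by rw [sq, sgn_mul_self]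
  have h1 : ∑ u, pderiv (toVec.symm u) (quad (heis a b c).1) ^ 2 =
      C ((1 + sgn (b ⬝ᵥ a)) ^ 2) * normForm m := by
    rw [normForm_eq, ← Equiv.sum_comp (Equiv.addLeft a), Finset.mul_sum]
    refine Finset.sum_congr rfl fun u _ => ?_
    rw [pderiv_quad_heis, mul_pow, ← C_pow, mul_pow, hs, mul_one, Equiv.coe_addLeft]
    beta_reduce
    rw [← add_assoc, ZModModule.add_self, zero_add]
  have h2 : C (1 + sgn (b ⬝ᵥ a)) * quad (heis a b c).1 = 2 * quad (heis a b c).1 := by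
    have hc : ∀ x : ℝ, (C (1 + x) : Poly m) = 1 + C x := fun x => by rw [C_add, C_1]
    rw [hc, add_mul, quad_heis_self_eq]
    ring
  have h3 : quad (heis a b c).1 ^ 2 * C ((1 + sgn (b ⬝ᵥ a)) ^ 2) =
      4 * quad (heis a b c).1 ^ 2 := by
    rw [C_pow, ← mul_pow, mul_comm, h2]
    ring
  have h8 : 12 * quad (heis a b c).1 ^ 2 * (C ((1 + sgn (b ⬝ᵥ a)) ^ 2) * normForm m) =
      48 * quad (heis a b c).1 ^ 2 * normForm m := by
    linear_combination 12 * normForm m * h3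
  rw [laplacian_pow_four, h1, laplacian_quad_heis, h8]
  refine congrArg _ ?_
  split_ifs with h
  · obtain ⟨rfl, rfl⟩ := h
    have h4 : quad (heis (0 : Fin m → ZMod 2) 0 c).1 = C (sgn c) * normForm m := by
      rw [quad_heis, normForm_eq, Finset.mul_sum]
      simp [sq]
    have h5 : (C (sgn c) : Poly m) ^ 4 = 1 := by
      rw [← C_pow, show (4 : ℕ) = 2 * 2 from rfl, pow_mul, hs, one_pow, C_1]
    have h6 : (C (2 * 2 ^ m * sgn c) : Poly m) = 2 * 2 ^ m * C (sgn c) := by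
      rw [map_mul, map_mul, map_pow, map_ofNat]
    have h7 : (C (8 * 2 ^ m) : Poly m) = 8 * 2 ^ m := by
      simp only [map_mul, map_pow, map_ofNat]
    rw [h4, h6, h7]
    linear_combination 8 * 2 ^ m * normForm m ^ 3 * h5
  · simp

/-- The parameters of the elements of the extraspecial group. -/
abbrev HeisParam (m : ℕ) : Type := (Fin m → ZMod 2) × (Fin m → ZMod 2) × ZMod 2

theorem heis_injective :
    Function.Injective fun t : HeisParam m => heis t.1 t.2.1 t.2.2 := by
  have h01 : ∀ x : ZMod 2, sgn x ≠ 0 := fun x h => by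
    have := sgn_mul_self x
    simp [h] at this
  have hsgn : Function.Injective sgn := by
    intro x y h
    rw [← sub_eq_zero]
    refine eq_zero_of_sgn_eq_one ?_
    rw [ZModModule.sub_eq_add, sgn_add, h, sgn_mul_self]
  rintro ⟨a, b, c⟩ ⟨a', b', c'⟩ h
  have hent : ∀ u v : Idx m, (heis a b c).1 u v = (heis a' b' c').1 u v := fun u v =>
    congrFun (congrFun (congrArg Subtype.val h) u) v
  have ha : a = a' := by
    have h1 := hent (toVec.symm a) (toVec.symm 0)
    by_contra hne
    simp [heis, signedPerm_apply, hne, h01] at h1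
  subst ha
  have hq : ∀ v, b ⬝ᵥ v + c = b' ⬝ᵥ v + c' := by
    intro v
    have h1 := hent (toVec.symm (a + v)) (toVec.symm v)
    simp only [heis, signedPerm_apply, Equiv.apply_symm_apply, Equiv.coe_addLeft, if_true] at h1
    exact hsgn h1
  have hc : c = c' := by simpa using hq 0
  subst hc
  have hb : b = b' := by
    funext i
    simpa using hq (Pi.single i 1)
  rw [hb]

/-- The sum of the fourth powers of the quadratic forms of the extraspecial group. -/
def fourthPowerSum (m : ℕ) : Poly m :=
  ∑ t : HeisParam m, quad (heis t.1 t.2.1 t.2.2).1 ^ 4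

theorem subst_quad_orth (g n : Orth m) : subst g.1 (quad n.1) = quad (g⁻¹ * n * g).1 :=
  subst_quad _ _

/-- Conjugation by `g` permutes the elements of `E(m)`. -/
theorem subst_fourthPowerSum [NeZero m] {g : Orth m} (hg : g ∈ cliffordGroup m) :
    subst g.1 (fourthPowerSum m) = fourthPowerSum m := by
  have h1 : ∀ t : HeisParam m, ∃ t' : HeisParam m,
      g⁻¹ * heis t.1 t.2.1 t.2.2 * g = heis t'.1 t'.2.1 t'.2.2 := by
    intro t
    have h2 := (Subgroup.mem_normalizer_iff.1 (inv_mem hg) (heis t.1 t.2.1 t.2.2)).1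
      (heis_mem_extraspecial _ _ _)
    rw [inv_inv] at h2
    obtain ⟨a, b, c, h3⟩ := mem_extraspecial.1 h2
    exact ⟨(a, b, c), h3⟩
  choose f hf using h1
  have hinj : Function.Injective f := by
    intro s t hst
    apply heis_injective
    have h2 := (hf s).trans ((congrArg (fun t : HeisParam m => heis t.1 t.2.1 t.2.2) hst).trans
      (hf t).symm)
    exact mul_left_cancel (mul_right_cancel h2)
  rw [fourthPowerSum, map_sum]
  refine Fintype.sum_bijective f (Finite.injective_iff_bijective.1 hinj) _ _ fun t => ?_
  rw [map_pow, subst_quad_orth, hf]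

theorem subst_normForm (g : Orth m) : subst g.1 (normForm m) = normForm m := by
  have := subst_quad_orth g 1
  rwa [mul_one, inv_mul_cancel] at this

/-- After squaring, the sum over `b` forces `v = w`; with the two signs `c` this gives the factor `2
* 2 ^ m`, and summing over `a` and `v` gives `|x|⁴`. -/
theorem sum_quad_heis_sq :
    ∑ t : HeisParam m, quad (heis t.1 t.2.1 t.2.2).1 ^ 2 = C (2 * 2 ^ m) * normForm m ^ 2 := by
  have h1 : ∀ t : HeisParam m, quad (heis t.1 t.2.1 t.2.2).1 ^ 2 =
      ∑ v, ∑ w, C (sgn ((v + w) ⬝ᵥ t.2.1)) *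
        ((coord (t.1 + v) * coord v) * (coord (t.1 + w) * coord w)) := by
    rintro ⟨a, b, c⟩
    rw [quad_heis, sq, Finset.sum_mul_sum]
    refine Finset.sum_congr rfl fun v _ => Finset.sum_congr rfl fun w _ => ?_
    have h2 : sgn ((v + w) ⬝ᵥ b) = sgn (b ⬝ᵥ v + c) * sgn (b ⬝ᵥ w + c) := by
      rw [← sgn_add, dotProduct_comm, dotProduct_add, add_add_add_comm, ZModModule.add_self c,
        add_zero]
    rw [h2, C_mul]
    ring
  have h3 : ∀ v w : Fin m → ZMod 2, ∑ b : Fin m → ZMod 2, ∑ _c : ZMod 2, sgn ((v + w) ⬝ᵥ b) =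
      if v = w then 2 * 2 ^ m else 0 := by
    intro v w
    have h4 := sum_sgn_dotProduct_univ (v + w) 0
    have h5 : v + w = 0 ↔ v = w := by rw [← ZModModule.sub_eq_add, sub_eq_zero]
    simp only [add_zero, sgn_zero, mul_one, h5] at h4
    simp only [Finset.sum_const, Finset.card_univ, ZMod.card, nsmul_eq_mul, ← Finset.mul_sum, h4]
    split_ifs <;> simp
  simp only [h1]
  rw [Fintype.sum_prod_type]
  simp only [Fintype.sum_prod_type]
  have h6 : ∀ a : Fin m → ZMod 2, (∑ b : Fin m → ZMod 2, ∑ _c : ZMod 2, ∑ v, ∑ w,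
      C (sgn ((v + w) ⬝ᵥ b)) * ((coord (a + v) * coord v) * (coord (a + w) * coord w))) =
      ∑ v, C (2 * 2 ^ m) * (coord (a + v) ^ 2 * coord v ^ 2) := by
    intro a
    have h7 : ∀ f : (Fin m → ZMod 2) → (Fin m → ZMod 2) → (Fin m → ZMod 2) → Poly m,
        ∑ b, ∑ _c : ZMod 2, ∑ v, ∑ w, f b v w = ∑ v, ∑ w, ∑ b, ∑ _c : ZMod 2, f b v w := by
      intro f
      simp only [Finset.sum_const]
      rw [← Finset.smul_sum, Finset.sum_comm]
      simp only [← Finset.smul_sum]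
      congr 1
      exact Finset.sum_congr rfl fun v _ => Finset.sum_comm
    rw [h7]
    refine Finset.sum_congr rfl fun v _ => ?_
    simp only [← Finset.sum_mul, ← map_sum, h3]
    rw [Finset.sum_eq_single v]
    · rw [if_pos rfl]; ring
    · intro w _ hw
      rw [if_neg hw.symm]; simp
    · simp
  simp only [h6]
  rw [Finset.sum_comm, normForm_eq, sq, Finset.sum_mul_sum, Finset.mul_sum]
  refine Finset.sum_congr rfl fun v _ => ?_
  rw [← Equiv.sum_comp (Equiv.addRight v) fun w => coord v ^ 2 * coord w ^ 2, Finset.mul_sum]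
  refine Finset.sum_congr rfl fun a _ => ?_
  rw [Equiv.coe_addRight]
  ring

theorem laplacian_fourthPowerSum :
    laplacian m (fourthPowerSum m) = C (112 * 2 ^ m) * normForm m ^ 3 := by
  rw [fourthPowerSum, map_sum]
  simp only [laplacian_quad_heis_pow_four, Finset.sum_add_distrib]
  rw [← Finset.sum_mul, ← Finset.mul_sum, sum_quad_heis_sq]
  have h1 : ∑ t : HeisParam m, (if t.1 = 0 ∧ t.2.1 = 0 then C (8 * 2 ^ m) * normForm m ^ 3 else 0) =
      2 * (C (8 * 2 ^ m) * normForm m ^ 3) := by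
    rw [Fintype.sum_prod_type, Finset.sum_eq_single 0 (fun a _ ha => by simp [ha]) (by simp),
      Fintype.sum_prod_type, Finset.sum_eq_single 0 (fun b _ hb => by simp [hb]) (by simp)]
    simp
  rw [h1]
  have h2 : (C (8 * 2 ^ m) : Poly m) = 8 * 2 ^ m := by
    simp only [map_mul, map_pow, map_ofNat]
  have h3 : (C (2 * 2 ^ m) : Poly m) = 2 * 2 ^ m := by
    simp only [map_mul, map_pow, map_ofNat]
  have h4 : (C (112 * 2 ^ m) : Poly m) = 112 * 2 ^ m := by
    simp only [map_mul, map_pow, map_ofNat]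
  rw [h2, h3, h4]
  -- `112 = 48 · 2 + 2 · 8`, the last term coming from the two elements `±1`.
  ring

theorem laplacian_normForm_pow_four :
    laplacian m (normForm m ^ 4) = C (8 * (2 ^ m + 6)) * normForm m ^ 3 := by
  have h1 := laplacian_quad_heis_pow_four (0 : Fin m → ZMod 2) 0 0
  rw [heis_zero, if_pos ⟨rfl, rfl⟩] at h1
  change laplacian m (normForm m ^ 4) = 48 * normForm m ^ 2 * normForm m + _ at h1
  have h2 : (C (8 * 2 ^ m) : Poly m) = 8 * 2 ^ m := by
    simp only [map_mul, map_pow, map_ofNat]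
  have h3 : (C (8 * (2 ^ m + 6)) : Poly m) = 8 * (2 ^ m + 6) := by
    simp only [map_mul, map_add, map_pow, map_ofNat]
  rw [h3]
  rw [h2] at h1
  rw [h1]
  ring

/-- A harmonic invariant of degree eight. -/
def harmonicOctic (m : ℕ) : Poly m :=
  ((2 : ℝ) ^ m + 6) • fourthPowerSum m - (14 * (2 : ℝ) ^ m) • normForm m ^ 4

theorem harmonicOctic_mem [NeZero m] : harmonicOctic m ∈ harmonicInvariants m 8 := by
  refine ⟨⟨?_, ?_⟩, fun g hg => ?_⟩
  · refine Submodule.sub_mem _ (Submodule.smul_mem _ _ (Submodule.sum_mem _ fun t _ => ?_))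
      (Submodule.smul_mem _ _ ?_)
    · exact (quad_isHomogeneous _).pow 4
    · exact (quad_isHomogeneous _).pow 4
  -- The coefficients of `harmonicOctic` are chosen so that `112 = 14 · 8` cancels.
  · rw [SetLike.mem_coe, LinearMap.mem_ker, harmonicOctic, map_sub, map_smul, map_smul,
      laplacian_fourthPowerSum, laplacian_normForm_pow_four, smul_eq_C_mul, smul_eq_C_mul,
      ← mul_assoc, ← mul_assoc, ← C_mul, ← C_mul, ← sub_mul, ← C_sub]
    ring_nf
    simp
  · rw [harmonicOctic, map_sub, map_smul, map_smul, map_pow, subst_fourthPowerSum hg,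
      subst_normForm]

/-- At a basis vector the value is `2 · 2^m (2^m - 1)`, positive for `m ≥ 1`. -/
theorem harmonicOctic_ne_zero [NeZero m] : harmonicOctic m ≠ 0 := by
  intro h
  have h1 := congrArg (eval (Pi.single (toVec.symm 0) 1)) h
  have h2 : ∀ t : HeisParam m, eval (Pi.single (toVec.symm 0) 1)
      (quad (heis t.1 t.2.1 t.2.2).1 ^ 4) = if t.1 = 0 then 1 else 0 := by
    rintro ⟨a, b, c⟩
    rw [map_pow, eval_quad, heis, signedPerm_apply]
    by_cases ha : a = 0
    · have h4 : sgn c ^ 4 = 1 := by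
        rw [show (4 : ℕ) = 2 * 2 from rfl, pow_mul, sq (sgn c), sgn_mul_self, one_pow]
      simp [ha, h4]
    · simp [ha, eq_comm]
  have h3 : eval (Pi.single (toVec.symm 0) 1) (fourthPowerSum m) = 2 * 2 ^ m := by
    rw [fourthPowerSum, map_sum, Finset.sum_congr rfl fun t _ => h2 t]
    rw [Fintype.sum_prod_type, Finset.sum_eq_single 0 (fun a _ ha => by simp [ha]) (by simp)]
    simp [mul_comm]
  rw [harmonicOctic, map_sub, smul_eval, smul_eval, map_pow, normForm, eval_quad, h3] at h1
  simp only [Matrix.one_apply_eq, one_pow, mul_one, map_zero] at h1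
  have hm : 1 ≤ m := Nat.one_le_iff_ne_zero.2 (NeZero.ne m)
  have h5 : (2 : ℝ) ^ 1 ≤ 2 ^ m := pow_le_pow_right₀ (by norm_num) hm
  nlinarith

end DegreeEight

/-! ### Conclusion -/

theorem finrank_harmonicInvariants_eight {m : ℕ} [NeZero m] :
    Module.finrank ℝ (harmonicInvariants m 8) = 1 := by
  obtain ⟨φ, hφ⟩ := exists_injective_harmonicInvariants_eight (m := m)
  have : Module.Finite ℝ (harmonicInvariants m 8) := Module.Finite.of_injective φ hφ
  have h1 := LinearMap.finrank_le_finrank_of_injective hφ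
  have : Nontrivial (harmonicInvariants m 8) :=
    ⟨⟨harmonicOctic m, harmonicOctic_mem⟩, 0, fun h => harmonicOctic_ne_zero
      (congrArg Subtype.val h)⟩
  have h2 : 0 < Module.finrank ℝ (harmonicInvariants m 8) := Module.finrank_pos
  rw [Module.finrank_self] at h1
  omega

end

theorem mainTheorem12 (m : ℕ) (hm : 1 ≤ m) :
    IsLeast {d : ℕ | 0 < d ∧ ∃ p ∈ CliffordGroup.harmonicInvariants m d, p ≠ 0} 8 ∧
    Module.finrank ℝ (CliffordGroup.harmonicInvariants m 8) = 1 ∧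
    CliffordGroup.harmonicInvariants m 10 = ⊥ := by
  have : NeZero m := ⟨by omega⟩
  refine ⟨⟨⟨by norm_num, harmonicOctic m, harmonicOctic_mem, harmonicOctic_ne_zero⟩, ?_⟩,
    finrank_harmonicInvariants_eight, ?_⟩
  · rintro d ⟨hd, p, hp, hp0⟩
    by_contra! hlt
    refine hp0 ?_
    rcases Nat.even_or_odd d with he | ho
    · obtain ⟨k, hk⟩ := he
      exact eq_zero_of_codeSum_eq_zero ⟨k, hk⟩ hp fun C hC hC2 =>
        (not_noWeightTwo_of_le_six (k := k) (by omega) (by omega) (by omega) hC hC2).elim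
    · exact eq_zero_of_odd ho hp
  · rw [Submodule.eq_bot_iff]
    intro p hp
    exact eq_zero_of_codeSum_eq_zero (by decide) hp fun C hC hC2 =>
      (not_noWeightTwo_ten hC hC2).elim
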